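/- For $M\ge 1$ write $[M]=\{0,1,\dots,M-1\}$. For $X\subseteq[M]^n$ (the promise) and $f:X\to\{0,1\}$, let $R(f)$ be the least $q$ such that some randomized algorithm (a probability distribution over deterministic decision trees querying entries of $x$) making at most $q$ queries outputs $f(x)$ with error probability less than $1/3$ for every $x\in X$. Let $Q(f)$ be the least $q$ such that some quantum algorithm making $q$ queries (input-independent unitaries on a finite-dimensional space, interleaved with $q$ applications of the query operator $|i,b,w\rangle\mapsto|i,b+x_i \bmod M,w\rangle$, followed by a measurement in the computational basis) outputs $f(x)$ with error probability less than $1/3$ for every $x\in X$. Call $X\subseteq[M]^n$ symmetric if $(x_{\sigma(1)},\dots,x_{\sigma(n)})\in X$ for all $x\in X$ and $\sigma\in S_n$. **Theorem.** For every integer $M\ge 2$ there is a constant $c>0$, depending only on $M$, such that for every $n\ge 0$, every symmetric $X\subseteq[M]^n$ and every function $f:X\to\{0,1\}$ (not necessarily symmetric), $$Q(f)\ \ge\ c\,R(f)^{1/(12(M-1))}.$$ In particular, for $M=2$ there is an absolute constant $c>0$ such that $Q(f)\ge c\,R(f)^{1/12}$ for every $n$, every symmetric $X\subseteq\{0,1\}^n$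 and every $f:X\to\{0,1\}$. -/

import Mathlib

namespace QueryComplexity

/-! ### Randomized query algorithms -/

/-- Deterministic query algorithms (decision trees) on inputs `x ∈ [M]^n`: a leaf outputs a bit,
an inner node queries an index `i` and continues according to the answer `x i`. -/
inductive DecisionTree (n M : ℕ) : Type
  | leaf (b : Bool) : DecisionTree n M
  | query (i : Fin n) (next : Fin M → DecisionTree n M) : DecisionTree n M

namespace DecisionTree

/-- The output on input `x`. -/
def eval {n M : ℕ} : DecisionTree n M → (Fin n → Fin M) → Bool
  | leaf b, _ => b
  | query i next, x => eval (next (x i)) x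

/-- The worst-case number of queries. -/
def depth {n M : ℕ} : DecisionTree n M → ℕ
  | leaf _ => 0
  | query _ next => 1 + Finset.univ.sup fun a => depth (next a)

end DecisionTree

/-- `f : X → {0,1}` can be computed by a randomized algorithm (a probability distribution over
decision trees) that never makes more than `q` queries and errs with probability less than `1/3`
on every input of the promise `X`. -/
def RandomizedComputable {n M : ℕ} {X : Set (Fin n → Fin M)} (f : X → Bool) (q : ℕ) : Prop :=
  ∃ μ : PMF (DecisionTree n M),
    (∀ T ∈ μ.support, T.depth ≤ q) ∧
    ∀ x : X, (μ.map fun T => T.eval x.1) (!f x) < 1 / 3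

/-- Bounded-error randomized query complexity `R(f)`; for nonempty alphabet the set is nonempty, as
`n` queries always suffice. -/
noncomputable def R {n M : ℕ} {X : Set (Fin n → Fin M)} (f : X → Bool) : ℕ :=
  sInf {q | RandomizedComputable f q}

/-! ### Quantum query algorithms -/

/-- Computational basis states `|i, b, w⟩`: query register `i`, answer register `b`, workspace `w`.
The value `none` of the query register stands for "no query". -/
abbrev Basis (n M : ℕ) (W : Type) : Type := Option (Fin n) × Fin M × W

/-- The query operator `|i, b, w⟩ ↦ |i, b + x_i mod M, w⟩` (and `|none, b, w⟩ ↦ |none, b, w⟩`),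
acting on amplitude vectors. -/
def oracle {n M : ℕ} {W : Type} (x : Fin n → Fin M) (ψ : Basis n M W → ℂ) : Basis n M W → ℂ
  | (some i, b, w) => ψ (some i, b - x i, w)
  | (none, b, w) => ψ (none, b, w)

/-- A quantum query algorithm: a finite-dimensional workspace, an initial basis state, the
input-independent unitaries `U 0, U 1, U 2, …` applied between the queries, and the output bit read
off from the final measurement in the computational basis. When it is run with `q` queries, only
`U 0, …, U q` are used. -/
structure QuantumAlgorithm (n M : ℕ) where
  W : Type
  [fintypeW : Fintype W]
  [decEqW : DecidableEq W]
  init : Basis n M W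
  U : ℕ → Matrix.unitaryGroup (Basis n M W) ℂ
  out : Basis n M W → Bool

namespace QuantumAlgorithm

attribute [instance] fintypeW decEqW

/-- The state `U_q O_x U_{q-1} ⋯ O_x U_0 |init⟩` after `q` queries to `x`. -/
noncomputable def state {n M : ℕ} (A : QuantumAlgorithm n M) (x : Fin n → Fin M) :
    ℕ → Basis n M A.W → ℂ
  | 0 => (A.U 0).1.mulVec (Pi.single A.init 1)
  | q + 1 => (A.U (q + 1)).1.mulVec (oracle x (A.state x q))

/-- The probability that the output is `b` when the state is measured after `q` queries to `x`. -/
noncomputable def prob {n M : ℕ} (A : QuantumAlgorithm n M) (q : ℕ) (x : Fin n → Fin M)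
    (b : Bool) : ℝ :=
  ∑ s with A.out s = b, ‖A.state x q s‖ ^ 2

end QuantumAlgorithm

/-- `f : X → {0,1}` can be computed by a quantum algorithm that makes `q` queries and errs with
probability less than `1/3` on every input of the promise `X`. -/
def QuantumComputable {n M : ℕ} {X : Set (Fin n → Fin M)} (f : X → Bool) (q : ℕ) : Prop :=
  ∃ A : QuantumAlgorithm n M, ∀ x : X, A.prob q x.1 (!f x) < 1 / 3

/-- Bounded-error quantum query complexity `Q(f)`; for nonempty alphabet the set is nonempty, as
`n` queries always suffice. -/
noncomputable def Q {n M : ℕ} {X : Set (Fin n → Fin M)} (f : X → Bool) : ℕ :=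
  sInf {q | QuantumComputable f q}

/-- The promise `X ⊆ [M]^n` is invariant under permuting the entries of its elements. -/
def IsSymmetric {n M : ℕ} (X : Set (Fin n → Fin M)) : Prop :=
  ∀ x ∈ X, ∀ σ : Equiv.Perm (Fin n), (fun i => x (σ i)) ∈ X

end QueryComplexity

namespace QueryComplexity

/-! ### The hybrid argument -/

/-! The quantum model enters only through `HasQueryMass`. By the hybrid argument, the acceptance
probability `F` of a `q`-query algorithm has, around each input `z`, weights on the indices of total
mass at most `K = 16 q²` such that `(F z - F y)²` is at most the mass of the set where `y` differs
from `z`. The rest is a classical simulation with `O(M⁵ K⁴)` queries, which gives `R ≤ 10¹⁸ M⁵ Q⁸`;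
this suffices because `8 ≤ 12 (M - 1)`.

Symmetry makes `F` decided far outside `X`. If the symbol counts of `z` are relatively close to
those of some `t ∈ X`, then within each symbol class the few surplus positions can be chosen cheap,
so a permutation of `t`, which lies again in `X`, is close to `z` in mass (`exists_cheap_perm`).
Hence `F z` stays away from `1/2` (`decided_of_rareLE`). On this larger domain the block sensitivity
argument works as for total functions: disjoint sensitive blocks number at most `25 K`, minimal ones
have at most `25 K` elements, and their union gives certificates of size `(25 K)²`
(`exists_window_certificate`).

Certificates for opposite values must intersect, since otherwise a hybrid input would satisfy both.
So reading certificates of candidate inputs repeatedly, with a majority vote over the guesses,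
determines `f` (`exists_proposal`, `eval_vote`). All this presupposes approximate symbol
frequencies, obtained by random sampling; this is the only use of randomness. Rare symbols cannot be
controlled in relative terms, so their counts are only bounded from above. If `n` is too small for
the estimates, the input is read entirely. -/

theorem sum_norm_sq_mulVec_unitary {ι : Type*} [Fintype ι] [DecidableEq ι]
    (U : Matrix.unitaryGroup ι ℂ) (ψ : ι → ℂ) :
    ∑ s, ‖U.1.mulVec ψ s‖ ^ 2 = ∑ s, ‖ψ s‖ ^ 2 := by
  have key : ∀ φ : ι → ℂ, ((∑ s, ‖φ s‖ ^ 2 : ℝ) : ℂ) = star φ ⬝ᵥ φ := by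
    intro φ
    simp [dotProduct, Complex.conj_mul']
  have h : star (U.1.mulVec ψ) ⬝ᵥ (U.1.mulVec ψ) = star ψ ⬝ᵥ ψ := by
    rw [Matrix.star_mulVec, Matrix.dotProduct_mulVec, Matrix.vecMul_vecMul]
    have h2 : U.1.conjTranspose * U.1 = 1 := Matrix.mem_unitaryGroup_iff'.1 U.2
    rw [h2, Matrix.vecMul_one]
  rw [← key, ← key] at h
  exact_mod_cast h

/-- The Euclidean norm of an amplitude vector. -/
noncomputable def ampNorm {ι : Type*} [Fintype ι] (ψ : ι → ℂ) : ℝ := ‖WithLp.toLp 2 ψ‖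

theorem ampNorm_sq {ι : Type*} [Fintype ι] (ψ : ι → ℂ) : ampNorm ψ ^ 2 = ∑ s, ‖ψ s‖ ^ 2 := by
  simp [ampNorm, EuclideanSpace.norm_sq_eq]

theorem ampNorm_nonneg {ι : Type*} [Fintype ι] (ψ : ι → ℂ) : 0 ≤ ampNorm ψ := norm_nonneg _

theorem ampNorm_add_le {ι : Type*} [Fintype ι] (ψ φ : ι → ℂ) :
    ampNorm (ψ + φ) ≤ ampNorm ψ + ampNorm φ := by
  simpa [ampNorm] using norm_add_le (WithLp.toLp 2 ψ) (WithLp.toLp 2 φ)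

theorem abs_ampNorm_sub_le {ι : Type*} [Fintype ι] (ψ φ : ι → ℂ) :
    |ampNorm ψ - ampNorm φ| ≤ ampNorm (ψ - φ) := by
  simpa [ampNorm] using abs_norm_sub_norm_le (WithLp.toLp 2 ψ) (WithLp.toLp 2 φ)

theorem ampNorm_eq_of_sum_eq {ι : Type*} [Fintype ι] {ψ φ : ι → ℂ}
    (h : ∑ s, ‖ψ s‖ ^ 2 = ∑ s, ‖φ s‖ ^ 2) : ampNorm ψ = ampNorm φ := by
  rw [← ampNorm_sq, ← ampNorm_sq] at h
  exact (sq_eq_sq₀ (ampNorm_nonneg _) (ampNorm_nonneg _)).1 h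

theorem ampNorm_mulVec_unitary {ι : Type*} [Fintype ι] [DecidableEq ι]
    (U : Matrix.unitaryGroup ι ℂ) (ψ : ι → ℂ) : ampNorm (U.1.mulVec ψ) = ampNorm ψ :=
  ampNorm_eq_of_sum_eq (sum_norm_sq_mulVec_unitary U ψ)

theorem sum_basis {n M : ℕ} {W : Type} [Fintype W] (g : Basis n M W → ℝ) :
    ∑ s, g s = (∑ p : Fin M × W, g (none, p)) + ∑ i, ∑ p : Fin M × W, g (some i, p) := by
  rw [Fintype.sum_prod_type, Fintype.sum_option]

theorem sum_shift {M : ℕ} {W : Type} [Fintype W] (c : Fin M) (g : Fin M × W → ℝ) :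
    ∑ p : Fin M × W, g (p.1 - c, p.2) = ∑ p : Fin M × W, g p := by
  have : NeZero M := ⟨by have := c.2; omega⟩
  rw [Fintype.sum_prod_type, Fintype.sum_prod_type]
  exact Equiv.sum_comp (Equiv.subRight c) fun b => ∑ w, g (b, w)

theorem ampNorm_oracle {n M : ℕ} {W : Type} [Fintype W] (x : Fin n → Fin M)
    (ψ : Basis n M W → ℂ) : ampNorm (oracle x ψ) = ampNorm ψ := by
  apply ampNorm_eq_of_sum_eq
  rw [sum_basis, sum_basis]
  congr 1
  refine Finset.sum_congr rfl fun i _ => ?_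
  exact sum_shift (x i) fun p => ‖ψ (some i, p)‖ ^ 2

theorem oracle_sub {n M : ℕ} {W : Type} (x : Fin n → Fin M) (ψ φ : Basis n M W → ℂ) :
    oracle x (ψ - φ) = oracle x ψ - oracle x φ := by
  funext s
  obtain ⟨_ | i, b, w⟩ := s <;> rfl

/-- The probability weight with which index `i` is queried in the state `ψ`. -/
noncomputable def queryWeight {n M : ℕ} {W : Type} [Fintype W] (ψ : Basis n M W → ℂ)
    (i : Fin n) : ℝ := ∑ p : Fin M × W, ‖ψ (some i, p)‖ ^ 2

theorem queryWeight_nonneg {n M : ℕ} {W : Type} [Fintype W] (ψ : Basis n M W → ℂ) (i : Fin n) :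
    0 ≤ queryWeight ψ i := Finset.sum_nonneg fun _ _ => sq_nonneg _

theorem sum_queryWeight_le {n M : ℕ} {W : Type} [Fintype W] (ψ : Basis n M W → ℂ) :
    ∑ i, queryWeight ψ i ≤ ampNorm ψ ^ 2 := by
  rw [ampNorm_sq, sum_basis]
  exact le_add_of_nonneg_left (Finset.sum_nonneg fun _ _ => sq_nonneg _)

/-- The two query operators act alike wherever `x` and `y` agree. Elsewhere `‖a - b‖² ≤ 2‖a‖² +
2‖b‖²`, and each shift of the answer register preserves the weight of the index, whence the factor
4. -/
theorem ampNorm_oracle_sub_le {n M : ℕ} {W : Type} [Fintype W] (x y : Fin n → Fin M)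
    (ψ : Basis n M W → ℂ) :
    ampNorm (oracle x ψ - oracle y ψ) ^ 2 ≤ 4 * ∑ i with x i ≠ y i, queryWeight ψ i := by
  rw [ampNorm_sq, sum_basis, Finset.mul_sum, Finset.sum_filter]
  have h0 : ∑ p : Fin M × W, ‖(oracle x ψ - oracle y ψ) (none, p)‖ ^ 2 = 0 := by
    refine Finset.sum_eq_zero fun p _ => ?_
    simp [oracle]
  rw [h0, zero_add]
  refine Finset.sum_le_sum fun i _ => ?_
  split_ifs with h
  · have key : ∀ p : Fin M × W, ‖(oracle x ψ - oracle y ψ) (some i, p)‖ ^ 2 ≤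
        2 * ‖ψ (some i, p.1 - x i, p.2)‖ ^ 2 + 2 * ‖ψ (some i, p.1 - y i, p.2)‖ ^ 2 := by
      intro p
      have h1 : ‖(oracle x ψ - oracle y ψ) (some i, p)‖ ≤
        ‖ψ (some i, p.1 - x i, p.2)‖ + ‖ψ (some i, p.1 - y i, p.2)‖ := norm_sub_le _ _
      have h2 := norm_nonneg ((oracle x ψ - oracle y ψ) (some i, p))
      nlinarith [sq_nonneg (‖ψ (some i, p.1 - x i, p.2)‖ - ‖ψ (some i, p.1 - y i, p.2)‖)]
    refine (Finset.sum_le_sum fun p _ => key p).trans (le_of_eq ?_)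
    rw [Finset.sum_add_distrib, ← Finset.mul_sum, ← Finset.mul_sum,
      sum_shift (x i) fun p => ‖ψ (some i, p)‖ ^ 2, sum_shift (y i) fun p => ‖ψ (some i, p)‖ ^ 2]
    simp only [queryWeight]
    ring
  · simp only [not_not] at h
    refine le_of_eq (Finset.sum_eq_zero fun p _ => ?_)
    simp [oracle, h]

namespace QuantumAlgorithm

theorem ampNorm_state {n M : ℕ} (A : QuantumAlgorithm n M) (x : Fin n → Fin M) (q : ℕ) :
    ampNorm (A.state x q) = 1 := by
  induction q with
  | zero =>
    rw [state, ampNorm_mulVec_unitary]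
    have h := ampNorm_sq (Pi.single A.init (1 : ℂ) : Basis n M A.W → ℂ)
    rw [Finset.sum_eq_single A.init (by intro b _ hb; simp [hb]) (by simp)] at h
    have h0 := ampNorm_nonneg (Pi.single A.init (1 : ℂ) : Basis n M A.W → ℂ)
    simp only [Pi.single_eq_same, norm_one] at h
    nlinarith
  | succ q ih => rw [state, ampNorm_mulVec_unitary, ampNorm_oracle, ih]

theorem ampNorm_state_sub_le {n M : ℕ} (A : QuantumAlgorithm n M) (x y : Fin n → Fin M) (q : ℕ) :
    ampNorm (A.state x q - A.state y q) ≤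
      ∑ k ∈ Finset.range q, ampNorm (oracle x (A.state x k) - oracle y (A.state x k)) := by
  induction q with
  | zero =>
    have h : A.state x 0 - A.state y 0 = 0 := by simp [state]
    rw [h]
    simp [ampNorm]
  | succ q ih =>
    rw [Finset.sum_range_succ, state, state, ← Matrix.mulVec_sub, ampNorm_mulVec_unitary]
    -- The first summand is the old error, carried isometrically by the query to `y`; the second is
    -- the new error, always measured on the run for `x`.
    have h : oracle x (A.state x q) - oracle y (A.state y q) =
        oracle y (A.state x q - A.state y q) +
          (oracle x (A.state x q) - oracle y (A.state x q)) := by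
      rw [oracle_sub]; abel
    rw [h]
    refine (ampNorm_add_le _ _).trans ?_
    rw [ampNorm_oracle]
    linarith

theorem abs_prob_sub_le {n M : ℕ} (A : QuantumAlgorithm n M) (x y : Fin n → Fin M) (q : ℕ)
    (b : Bool) : |A.prob q x b - A.prob q y b| ≤ 2 * ampNorm (A.state x q - A.state y q) := by
  let π : (Basis n M A.W → ℂ) → Basis n M A.W → ℂ := fun ψ s => if A.out s = b then ψ s else 0
  have hπ : ∀ ψ, ampNorm (π ψ) ^ 2 = ∑ s with A.out s = b, ‖ψ s‖ ^ 2 := by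
    intro ψ
    rw [ampNorm_sq, Finset.sum_filter]
    refine Finset.sum_congr rfl fun s _ => ?_
    by_cases h : A.out s = b <;> simp [π, h]
  have hle : ∀ ψ, ampNorm (π ψ) ≤ ampNorm ψ := by
    intro ψ
    refine le_of_sq_le_sq ?_ (ampNorm_nonneg _)
    rw [hπ, ampNorm_sq]
    exact Finset.sum_le_sum_of_subset_of_nonneg (Finset.filter_subset _ _)
      fun _ _ _ => sq_nonneg _
  have hsub : ∀ ψ φ, π (ψ - φ) = π ψ - π φ := by
    intro ψ φ
    funext s
    by_cases h : A.out s = b <;> simp [π, h]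
  have e : ∀ z, A.prob q z b = ampNorm (π (A.state z q)) ^ 2 := fun z => (hπ _).symm
  have h1 := abs_ampNorm_sub_le (π (A.state x q)) (π (A.state y q))
  rw [← hsub] at h1
  have h2 := h1.trans (hle _)
  have hx := hle (A.state x q)
  have hy := hle (A.state y q)
  rw [ampNorm_state] at hx hy
  have hx0 := ampNorm_nonneg (π (A.state x q))
  have hy0 := ampNorm_nonneg (π (A.state y q))
  rw [e, e, sq_sub_sq, abs_mul, abs_of_nonneg (by positivity)]
  exact mul_le_mul (by linarith) h2 (abs_nonneg _) (by norm_num)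

theorem prob_add_prob_not {n M : ℕ} (A : QuantumAlgorithm n M) (x : Fin n → Fin M) (q : ℕ)
    (b : Bool) : A.prob q x b + A.prob q x (!b) = 1 := by
  have h := ampNorm_sq (A.state x q)
  rw [ampNorm_state, ← Finset.sum_filter_add_sum_filter_not _ fun s => A.out s = b] at h
  rw [prob, prob]
  simp only [Bool.eq_not]
  linarith

end QuantumAlgorithm

/-- Around every input `z` the function `F` varies in a way controlled by a nonnegative weight on
the indices of total mass at most `K`. -/
def HasQueryMass {n M : ℕ} (F : (Fin n → Fin M) → ℝ) (K : ℝ) : Prop :=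
  ∀ z, ∃ ν : Fin n → ℝ, (∀ i, 0 ≤ ν i) ∧ ∑ i, ν i ≤ K ∧
    ∀ y, (F z - F y) ^ 2 ≤ ∑ i with z i ≠ y i, ν i

/-- Cauchy–Schwarz over the `q` steps turns the sum of hybrid errors into `q` times the sum of their
squares; the factors 4 from squaring `abs_prob_sub_le` and 4 from `ampNorm_oracle_sub_le` make 16.
The weights come from the run on `z` alone, so they serve every `y`. -/
theorem QuantumAlgorithm.hasQueryMass {n M : ℕ} (A : QuantumAlgorithm n M) (q : ℕ) (b : Bool) :
    HasQueryMass (fun x => A.prob q x b) (16 * (q : ℝ) ^ 2) := by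
  intro z
  refine ⟨fun i => 16 * q * ∑ k ∈ Finset.range q, queryWeight (A.state z k) i,
    fun i => mul_nonneg (by positivity) (Finset.sum_nonneg fun _ _ => queryWeight_nonneg _ _),
    ?_, fun y => ?_⟩
  · rw [← Finset.mul_sum, Finset.sum_comm]
    have h : ∑ k ∈ Finset.range q, ∑ i, queryWeight (A.state z k) i ≤ q := by
      refine (Finset.sum_le_sum (g := fun _ => (1 : ℝ)) fun k _ => ?_).trans (by simp)
      have := sum_queryWeight_le (A.state z k)
      rwa [A.ampNorm_state, one_pow] at this
    nlinarith [(Nat.cast_nonneg q : (0 : ℝ) ≤ q)]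
  · have h1 := A.abs_prob_sub_le z y q b
    have h2 := A.ampNorm_state_sub_le z y q
    have h3 := ampNorm_nonneg (A.state z q - A.state y q)
    have h4 := sq_sum_le_card_mul_sum_sq (s := Finset.range q)
      (f := fun k => ampNorm (oracle z (A.state z k) - oracle y (A.state z k)))
    have h5 : ∑ k ∈ Finset.range q,
        ampNorm (oracle z (A.state z k) - oracle y (A.state z k)) ^ 2 ≤
        4 * ∑ i with z i ≠ y i, ∑ k ∈ Finset.range q, queryWeight (A.state z k) i := by
      rw [Finset.sum_comm, Finset.mul_sum]
      exact Finset.sum_le_sum fun k _ => ampNorm_oracle_sub_le _ _ _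
    rw [Finset.card_range] at h4
    rw [← Finset.mul_sum, ← sq_abs]
    have hq : (0 : ℝ) ≤ q := Nat.cast_nonneg q
    have h6 : |A.prob q z b - A.prob q y b| ^ 2 ≤
        4 * (∑ k ∈ Finset.range q,
          ampNorm (oracle z (A.state z k) - oracle y (A.state z k))) ^ 2 := by
      have := pow_le_pow_left₀ (abs_nonneg _)
        (h1.trans (mul_le_mul_of_nonneg_left h2 (by norm_num : (0 : ℝ) ≤ 2))) 2
      rw [mul_pow] at this
      linarith
    nlinarith [mul_le_mul_of_nonneg_left h5 hq]

/-! ### Reading the whole input with a quantum algorithm -/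

theorem permMatrix_mem_unitaryGroup {ι : Type*} [Fintype ι] [DecidableEq ι] (e : Equiv.Perm ι) :
    (Matrix.of fun r c => if r = e c then (1 : ℂ) else 0) ∈ Matrix.unitaryGroup ι ℂ := by
  rw [Matrix.mem_unitaryGroup_iff']
  ext r c
  simp [Matrix.mul_apply, Matrix.star_apply, Matrix.one_apply, eq_comm]

/-- The unitary permuting the basis states by `e`. -/
def permUnitary {ι : Type*} [Fintype ι] [DecidableEq ι] (e : Equiv.Perm ι) :
    Matrix.unitaryGroup ι ℂ := ⟨_, permMatrix_mem_unitaryGroup e⟩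

theorem permUnitary_mulVec_single {ι : Type*} [Fintype ι] [DecidableEq ι] (e : Equiv.Perm ι)
    (s : ι) : (permUnitary e).1.mulVec (Pi.single s 1) = Pi.single (e s) 1 := by
  funext r
  simp [permUnitary, Pi.single_apply]

theorem oracle_single {n M : ℕ} {W : Type} [DecidableEq W] (x : Fin n → Fin M) (i : Fin n)
    (b : Fin M) (w : W) :
    oracle x (Pi.single ((some i, b, w) : Basis n M W) 1) =
      Pi.single ((some i, b + x i, w) : Basis n M W) 1 := by
  have : NeZero M := ⟨by have := b.2; omega⟩
  funext s
  obtain ⟨_ | j, c, v⟩ := s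
  · simp [oracle]
  · simp only [oracle, Pi.single_apply, Prod.mk.injEq, Option.some.injEq]
    refine if_congr ?_ rfl rfl
    refine and_congr_right fun h => and_congr_left fun _ => ?_
    subst h
    exact sub_eq_iff_eq_add

/-- Exchange the answer register with cell `i` of a workspace made of `n` cells. -/
def exchange {n M : ℕ} (i : Fin n) : Equiv.Perm (Basis n M (Fin n → Fin M)) where
  toFun s := (s.1, s.2.2 i, Function.update s.2.2 i s.2.1)
  invFun s := (s.1, s.2.2 i, Function.update s.2.2 i s.2.1)
  left_inv s := by simp
  right_inv s := by simp

/-- The query register in round `k`: index `k` as long as there is one. -/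
def register (n k : ℕ) : Option (Fin n) := if h : k < n then some ⟨k, h⟩ else none

/-- The quantum algorithm that reads the input entry by entry and applies `g` to the result. -/
def readAll {n M : ℕ} [NeZero M] (g : (Fin n → Fin M) → Bool) : QuantumAlgorithm n M where
  W := Fin n → Fin M
  init := (register n 0, 0, 0)
  U
    | 0 => 1
    | k + 1 => if h : k < n then
        permUnitary ((exchange ⟨k, h⟩).trans
          (Equiv.prodCongr (Equiv.swap (register n k) (register n (k + 1))) (Equiv.refl _)))
      else 1
  out s := g s.2.2

/-- Each round exchanges the answer `x k` with the still zero cell `k`, so the answer register is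
zero again for the next query. -/
theorem readAll_state {n M : ℕ} [NeZero M] (g : (Fin n → Fin M) → Bool) (x : Fin n → Fin M)
    (k : ℕ) (hk : k ≤ n) :
    (readAll g).state x k =
      Pi.single ((register n k, 0, fun j => if (j : ℕ) < k then x j else 0) :
        Basis n M (Fin n → Fin M)) 1 := by
  induction k with
  | zero =>
    exact Matrix.one_mulVec (Pi.single ((register n 0, 0, 0) : Basis n M (Fin n → Fin M)) 1)
  | succ k ih =>
    have hk' : k < n := hk
    rw [QuantumAlgorithm.state, ih hk'.le]
    have hreg : register n k = some ⟨k, hk'⟩ := by simp [register, hk']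
    have h2 := oracle_single (W := Fin n → Fin M) x ⟨k, hk'⟩ 0
      (fun j => if (j : ℕ) < k then x j else 0)
    rw [← hreg] at h2
    refine (congrArg _ h2).trans ?_
    have hU : (readAll g).U (k + 1) = permUnitary ((exchange ⟨k, hk'⟩).trans
        (Equiv.prodCongr (Equiv.swap (register n k) (register n (k + 1))) (Equiv.refl _))) :=
      dif_pos hk'
    rw [hU]
    refine (permUnitary_mulVec_single (ι := Basis n M (Fin n → Fin M)) _ _).trans ?_
    congr 1
    simp only [exchange, Equiv.trans_apply, Equiv.coe_fn_mk, Equiv.prodCongr_apply, Prod.map_apply,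
      Equiv.swap_apply_left, Equiv.refl_apply]
    refine Prod.ext rfl (Prod.ext (by simp) ?_)
    funext j
    by_cases hj : j = ⟨k, hk'⟩
    · subst hj; simp
    · have : (j : ℕ) ≠ k := fun h => hj (Fin.ext h)
      simp only [Function.update_of_ne hj]
      refine if_congr ?_ rfl rfl
      omega

/-- Needed so that the infimum defining `Q f` is attained rather than being the default value 0 of
an empty set. -/
theorem exists_quantumComputable {n M : ℕ} (hM : 0 < M) {X : Set (Fin n → Fin M)}
    (f : X → Bool) : ∃ q, QuantumComputable f q := by
  classical
  have : NeZero M := ⟨hM.ne'⟩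
  refine ⟨n, readAll fun x => if h : x ∈ X then f ⟨x, h⟩ else false, fun x => ?_⟩
  rw [QuantumAlgorithm.prob, readAll_state _ _ _ le_rfl, Finset.sum_eq_zero]
  · norm_num
  · intro s hs
    rw [Finset.mem_filter] at hs
    by_cases h : s = ((register n n, 0, fun j => if (j : ℕ) < n then x.1 j else 0) :
        Basis n M (Fin n → Fin M))
    · exfalso
      have h2 := hs.2
      rw [h] at h2
      simp [readAll] at h2
    · have h0 : (Pi.single ((register n n, 0, fun j => if (j : ℕ) < n then x.1 j else 0) :
          Basis n M (Fin n → Fin M)) 1 : Basis n M (Fin n → Fin M) → ℂ) s = 0 :=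
        Pi.single_eq_of_ne h 1
      exact (congrArg (fun v : ℂ => ‖v‖ ^ 2) h0).trans (by simp)


/-! ### Counting symbols -/

/-- The number of occurrences of the symbol `a` in `z`. -/
def cnt {n M : ℕ} (z : Fin n → Fin M) (a : Fin M) : ℕ := (Finset.univ.filter fun i => z i = a).card

theorem sum_cnt_eq_card {n M : ℕ} (z : Fin n → Fin M) (U : Finset (Fin M)) :
    ∑ a ∈ U, cnt z a = (Finset.univ.filter fun i => z i ∈ U).card := by
  rw [Finset.card_eq_sum_card_fiberwise (f := z) (t := U) (by intro i hi; simpa using hi)]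
  refine Finset.sum_congr rfl fun a ha => ?_
  rw [cnt, Finset.filter_filter]
  congr 1
  ext i
  simp only [Finset.mem_filter, Finset.mem_univ, true_and]
  exact ⟨fun h => ⟨h ▸ ha, h⟩, fun h => h.2⟩

theorem sum_cnt {n M : ℕ} (z : Fin n → Fin M) : ∑ a, (cnt z a : ℝ) = n := by
  have h := sum_cnt_eq_card z Finset.univ
  simp only [Finset.mem_univ, Finset.filter_true, Finset.card_univ, Fintype.card_fin] at h
  exact_mod_cast h

theorem cnt_update {n M : ℕ} (z : Fin n → Fin M) (i : Fin n) (b a : Fin M) :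
    (cnt (Function.update z i b) a : ℝ) =
      cnt z a - (if z i = a then 1 else 0) + if b = a then 1 else 0 := by
  have key : ∀ y : Fin n → Fin M, (cnt y a : ℝ) =
      (if y i = a then 1 else 0) + ∑ j ∈ Finset.univ.erase i, if y j = a then (1 : ℝ) else 0 := by
    intro y
    rw [Finset.add_sum_erase _ (fun j => if y j = a then (1 : ℝ) else 0) (Finset.mem_univ i), cnt,
      Finset.card_filter]
    push_cast
    rfl
  rw [key, key z]
  have h : ∑ j ∈ Finset.univ.erase i, (if Function.update z i b j = a then (1 : ℝ) else 0) =
      ∑ j ∈ Finset.univ.erase i, if z j = a then (1 : ℝ) else 0 := by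
    refine Finset.sum_congr rfl fun j hj => ?_
    rw [Function.update_of_ne (Finset.ne_of_mem_erase hj)]
  rw [h, Function.update_self]
  ring

theorem cnt_le_cnt_add_card {n M : ℕ} {z x : Fin n → Fin M} {S : Finset (Fin n)}
    (h : ∀ i, i ∉ S → z i = x i) (a : Fin M) : cnt z a ≤ cnt x a + S.card := by
  refine (Finset.card_le_card ?_).trans (Finset.card_union_le _ _)
  intro i hi
  rw [Finset.mem_filter] at hi
  by_cases hS : i ∈ S
  · exact Finset.mem_union_right _ hS
  · exact Finset.mem_union_left _ (by simpa [← h i hS] using hi.2)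

theorem sum_cnt_sub_le {n M : ℕ} (y x : Fin n → Fin M) (U : Finset (Fin M)) :
    ∑ a ∈ U, ((cnt y a : ℝ) - cnt x a) ≤
      (Finset.univ.filter fun i => y i ∈ U ∧ x i ∉ U).card := by
  rw [Finset.sum_sub_distrib, sub_le_iff_le_add]
  have h1 := sum_cnt_eq_card y U
  have h2 := sum_cnt_eq_card x U
  have h3 : (Finset.univ.filter fun i => y i ∈ U).card ≤
      (Finset.univ.filter fun i => y i ∈ U ∧ x i ∉ U).card +
        (Finset.univ.filter fun i => x i ∈ U).card := by
    refine (Finset.card_le_card ?_).trans (Finset.card_union_le _ _)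
    intro i hi
    by_cases h : x i ∈ U <;> simp_all
  rw [← h1, ← h2] at h3
  exact_mod_cast h3

/-! ### Moving cheaply to a given type -/

/-- The `e` cheapest elements have at most average weight; induction removes the most expensive
element of `S`. -/
theorem exists_cheap_subset {ι : Type*} [DecidableEq ι] (ν : ι → ℝ) (S : Finset ι) (e : ℕ)
    (he : e ≤ S.card) (hν : ∀ i, 0 ≤ ν i) :
    ∃ T ⊆ S, T.card = e ∧ (S.card : ℝ) * ∑ i ∈ T, ν i ≤ e * ∑ i ∈ S, ν i := by
  obtain ⟨d, hd⟩ := Nat.exists_eq_add_of_le he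
  induction d generalizing S with
  | zero => exact ⟨S, subset_rfl, by omega, by simp [hd]⟩
  | succ d ih =>
    have hne : S.Nonempty := Finset.card_pos.1 (by omega)
    obtain ⟨i, hi, hmax⟩ := Finset.exists_max_image S ν hne
    have hcard := Finset.card_erase_of_mem hi
    obtain ⟨T, hT, hTe, hle⟩ := ih (S.erase i) (by omega) (by omega)
    refine ⟨T, hT.trans (Finset.erase_subset _ _), hTe, ?_⟩
    have h1 : ∑ j ∈ S, ν j ≤ S.card * ν i := by
      simpa using Finset.sum_le_card_nsmul S ν (ν i) hmax
    have h2 := Finset.add_sum_erase S ν hi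
    have h3 : ((S.erase i).card : ℝ) = S.card - 1 := by
      rw [hcard, Nat.cast_sub (by omega)]; simp
    have h0 : 0 ≤ ∑ j ∈ T, ν j := Finset.sum_nonneg fun j _ => hν j
    rw [h3] at hle
    rcases Nat.eq_zero_or_pos e with rfl | hepos
    · rw [Finset.card_eq_zero.1 hTe]; simp
    have hS : (2 : ℝ) ≤ S.card := by exact_mod_cast (by omega : 2 ≤ S.card)
    have h4 : (S.card : ℝ) * ∑ j ∈ S.erase i, ν j ≤ (S.card - 1) * ∑ j ∈ S, ν j := by
      nlinarith
    have he0 : (0 : ℝ) ≤ e := Nat.cast_nonneg e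
    have h5 : ((S.card : ℝ) - 1) * (S.card * ∑ j ∈ T, ν j) ≤
        ((S.card : ℝ) - 1) * (e * ∑ j ∈ S, ν j) := by
      nlinarith [mul_le_mul_of_nonneg_left h4 he0,
        mul_le_mul_of_nonneg_left hle (by linarith : (0 : ℝ) ≤ S.card)]
    exact le_of_mul_le_mul_left h5 (by linarith)

theorem exists_injOn_of_card_le {ι : Type*} {s t : Finset ι} (h : s.card ≤ t.card) :
    ∃ g : ι → ι, (∀ i ∈ s, g i ∈ t) ∧ Set.InjOn g s := by
  classical
  obtain ⟨e⟩ : Nonempty (s ↪ t) := Function.Embedding.nonempty_of_card_le (by simpa using h)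
  refine ⟨fun i => if hi : i ∈ s then (e ⟨i, hi⟩ : ι) else i, fun i hi => by simp [hi], ?_⟩
  intro i hi j hj hij
  have hi' : i ∈ s := hi
  have hj' : j ∈ s := hj
  simp only [hi', hj', dite_true] at hij
  exact congrArg Subtype.val (e.injective (Subtype.ext hij))

/-- In each symbol class of `z` the surplus over `t` is sacrificed at its cheapest positions,
costing at most a fraction `p` of the mass of the class. The remaining positions inject into those
of `t` with the same symbol, and the union of these injections extends to a permutation. -/
theorem exists_cheap_perm {n M : ℕ} (z t : Fin n → Fin M) (ν : Fin n → ℝ) (hν : ∀ i, 0 ≤ ν i)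
    {p : ℝ} (hp : 0 ≤ p) (h : ∀ a, (cnt z a : ℝ) - cnt t a ≤ p * cnt z a) :
    ∃ σ : Equiv.Perm (Fin n), ∑ i with z i ≠ t (σ i), ν i ≤ p * ∑ i, ν i := by
  choose T hTsub hTcard hTν using fun a => exists_cheap_subset ν
    (Finset.univ.filter fun i => z i = a) (cnt z a - cnt t a) (Nat.sub_le _ _) hν
  have hT : ∀ a, ∑ i ∈ T a, ν i ≤ p * ∑ i with z i = a, ν i := by
    intro a
    have hS : 0 ≤ ∑ i with z i = a, ν i := Finset.sum_nonneg fun i _ => hν i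
    rcases Nat.eq_zero_or_pos (cnt z a) with h0 | hpos
    · have : T a = ∅ := by rw [← Finset.card_eq_zero, hTcard, h0, Nat.zero_sub]
      rw [this, Finset.sum_empty]
      exact mul_nonneg hp hS
    · have hpos' : (0 : ℝ) < cnt z a := Nat.cast_pos.2 hpos
      have h1 : ((cnt z a - cnt t a : ℕ) : ℝ) ≤ p * cnt z a := by
        rcases le_total (cnt z a) (cnt t a) with hle | hle
        · rw [Nat.sub_eq_zero_of_le hle]; simp only [Nat.cast_zero]; positivity
        · rw [Nat.cast_sub hle]; exact h a
      have h2 := hTν a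
      change (cnt z a : ℝ) * _ ≤ _ at h2
      refine le_of_mul_le_mul_left ?_ hpos'
      nlinarith [mul_le_mul_of_nonneg_right h1 hS]
  choose g hg hginj using fun a => exists_injOn_of_card_le
    (s := (Finset.univ.filter fun i => z i = a) \ T a) (t := Finset.univ.filter fun i => t i = a)
    (by
      rw [Finset.card_sdiff_of_subset (hTsub a), hTcard]
      change cnt z a - _ ≤ cnt t a
      omega)
  have hgt : ∀ i, i ∉ T (z i) → t (g (z i) i) = z i := by
    intro i hi
    simpa using hg (z i) i (by simp [hi])
  have hinj : Set.InjOn (fun i => g (z i) i) (Finset.univ.filter fun i => i ∉ T (z i)) := by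
    intro i hi j hj hij
    have hi' : i ∉ T (z i) := by simpa using hi
    have hj' : j ∉ T (z j) := by simpa using hj
    have hij' : g (z i) i = g (z j) j := hij
    have hz : z i = z j := by rw [← hgt i hi', hij', hgt j hj']
    rw [← hz] at hij' hj'
    exact hginj (z i) (by simp [hi']) (by simp [hz.symm, hj']) hij'
  obtain ⟨σ, hσ⟩ := Finset.exists_equiv_extend_of_card_eq (t := Finset.univ) (by simp)
    (Finset.subset_univ _) hinj
  let τ : Equiv.Perm (Fin n) := σ.trans (Equiv.subtypeUnivEquiv fun i => Finset.mem_univ i)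
  refine ⟨τ, ?_⟩
  calc ∑ i with z i ≠ t (τ i), ν i
      ≤ ∑ i ∈ Finset.univ.biUnion T, ν i := by
        refine Finset.sum_le_sum_of_subset_of_nonneg ?_ fun i _ _ => hν i
        intro i hi
        rw [Finset.mem_filter] at hi
        by_contra hn
        have hiT : i ∉ T (z i) := fun hmem =>
          hn (Finset.mem_biUnion.2 ⟨z i, Finset.mem_univ _, hmem⟩)
        have h1 : τ i = g (z i) i := hσ i (by simp [hiT])
        exact hi.2 (by rw [h1, hgt i hiT])
    _ ≤ ∑ a, ∑ i ∈ T a, ν i := by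
        rw [Finset.sum_biUnion]
        intro a _ b _ hab
        refine Finset.disjoint_left.2 fun i hia hib => hab ?_
        have h1 := hTsub a hia
        have h2 := hTsub b hib
        simp only [Finset.mem_filter, Finset.mem_univ, true_and] at h1 h2
        rw [← h1, h2]
    _ ≤ ∑ a, p * ∑ i with z i = a, ν i := Finset.sum_le_sum fun a _ => hT a
    _ = p * ∑ i, ν i := by
        rw [← Finset.mul_sum, Finset.sum_fiberwise]

/-! ### Certificates -/

/-- The side of `1/2` on which `F` lies. -/
noncomputable def side {n M : ℕ} (F : (Fin n → Fin M) → ℝ) (y : Fin n → Fin M) : Bool :=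
  decide (1 / 2 < F y)

/-- `F y` is bounded away from `1/2`. -/
def Decided {n M : ℕ} (F : (Fin n → Fin M) → ℝ) (y : Fin n → Fin M) : Prop :=
  F y ≤ 2 / 5 ∨ 3 / 5 ≤ F y

theorem sq_sub_of_side_ne {n M : ℕ} {F : (Fin n → Fin M) → ℝ} {x y : Fin n → Fin M}
    (hx : Decided F x) (hy : Decided F y) (h : side F y ≠ side F x) :
    1 / 25 ≤ (F x - F y) ^ 2 := by
  have key : ∀ z, Decided F z → (side F z = true ∧ 3 / 5 ≤ F z) ∨
      (side F z = false ∧ F z ≤ 2 / 5) := by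
    rintro z (hz | hz)
    · exact Or.inr ⟨by simp only [side, decide_eq_false_iff_not]; linarith, hz⟩
    · exact Or.inl ⟨by simp only [side, decide_eq_true_eq]; linarith, hz⟩
  rcases key x hx with ⟨h1, h2⟩ | ⟨h1, h2⟩ <;> rcases key y hy with ⟨h3, h4⟩ | ⟨h3, h4⟩
  · exact absurd (h3.trans h1.symm) h
  · nlinarith
  · nlinarith
  · exact absurd (h3.trans h1.symm) h

/-- The set of indices where `x` and `y` differ. -/
def diff {n M : ℕ} (x y : Fin n → Fin M) : Finset (Fin n) := Finset.univ.filter fun i => x i ≠ y i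

theorem mem_diff {n M : ℕ} {x y : Fin n → Fin M} {i : Fin n} : i ∈ diff x y ↔ x i ≠ y i := by
  simp [diff]

/-- Crossing from one side to the other changes `F` by at least `3/5 - 2/5`, so every sensitive
block carries mass at least `1/25` of a total of `K`. -/
theorem card_sensitive_blocks_le {n M K : ℕ} {F : (Fin n → Fin M) → ℝ} (hF : HasQueryMass F K)
    {x : Fin n → Fin M} (hx : Decided F x) (𝓑 : Finset (Finset (Fin n)))
    (hdisj : (𝓑 : Set (Finset (Fin n))).PairwiseDisjoint id)
    (h : ∀ B ∈ 𝓑, ∃ y, diff x y ⊆ B ∧ Decided F y ∧ side F y ≠ side F x) :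
    𝓑.card ≤ 25 * K := by
  obtain ⟨ν, hν, hsum, hle⟩ := hF x
  have h1 : ∀ B ∈ 𝓑, (1 / 25 : ℝ) ≤ ∑ i ∈ B, ν i := by
    intro B hB
    obtain ⟨y, hyB, hy, hne⟩ := h B hB
    exact (sq_sub_of_side_ne hx hy hne).trans ((hle y).trans
      (Finset.sum_le_sum_of_subset_of_nonneg hyB fun i _ _ => hν i))
  have h2 : (𝓑.card : ℝ) * (1 / 25) ≤ K := by
    calc (𝓑.card : ℝ) * (1 / 25) ≤ ∑ B ∈ 𝓑, ∑ i ∈ B, ν i := by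
          simpa using Finset.card_nsmul_le_sum 𝓑 (fun B => ∑ i ∈ B, ν i) (1 / 25) h1
      _ = ∑ i ∈ 𝓑.biUnion id, ν i := (Finset.sum_biUnion hdisj).symm
      _ ≤ ∑ i, ν i := Finset.sum_le_sum_of_subset_of_nonneg (Finset.subset_univ _)
          fun i _ _ => hν i
      _ ≤ K := hsum
  have h3 : (𝓑.card : ℝ) ≤ 25 * K := by linarith
  exact_mod_cast h3

/-- Certificates from short minimal sensitive blocks. -/
theorem exists_certificate {n M K L : ℕ} {F : (Fin n → Fin M) → ℝ} (hF : HasQueryMass F K)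
    (D : Set (Fin n → Fin M)) (hD : ∀ y ∈ D, Decided F y) {x : Fin n → Fin M} (hx : x ∈ D)
    (hmin : ∀ y ∈ D, side F y ≠ side F x →
      (∀ y' ∈ D, side F y' ≠ side F x → ¬ diff x y' ⊂ diff x y) → (diff x y).card ≤ L) :
    ∃ S : Finset (Fin n), S.card ≤ 25 * K * L ∧
      ∀ y ∈ D, (∀ i ∈ S, y i = x i) → side F y = side F x := by
  classical
  let blocks : Finset (Finset (Fin n)) := Finset.univ.filter fun B =>
    ∃ y ∈ D, side F y ≠ side F x ∧ diff x y = B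
  let families : Finset (Finset (Finset (Fin n))) := Finset.univ.filter fun 𝓑 =>
    (𝓑 : Set (Finset (Fin n))).PairwiseDisjoint id ∧ ∀ B ∈ 𝓑, Minimal (· ∈ blocks) B
  have hblocks : ∀ B, B ∈ blocks ↔ ∃ y ∈ D, side F y ≠ side F x ∧ diff x y = B := by
    simp [blocks]
  have hne : families.Nonempty := ⟨∅, by simp [families]⟩
  -- The certificate is the union of a largest disjoint family of minimal sensitive blocks.
  obtain ⟨𝓑, h𝓑, hmax⟩ := Finset.exists_max_image families Finset.card hne
  obtain ⟨hdisj, hB⟩ : (𝓑 : Set (Finset (Fin n))).PairwiseDisjoint id ∧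
    ∀ B ∈ 𝓑, Minimal (· ∈ blocks) B := by simpa [families] using h𝓑
  have hcard : 𝓑.card ≤ 25 * K := by
    refine card_sensitive_blocks_le hF (hD x hx) 𝓑 hdisj fun B hB' => ?_
    obtain ⟨y, hy, hne, he⟩ := (hblocks B).1 (hB B hB').prop
    exact ⟨y, he.subset, hD y hy, hne⟩
  have hL : ∀ B ∈ 𝓑, B.card ≤ L := by
    intro B hB'
    obtain ⟨y, hy, hne, rfl⟩ := (hblocks B).1 (hB B hB').prop
    refine hmin y hy hne fun y' hy' hne' hss => ?_
    exact hss.2 ((hB _ hB').le_of_le ((hblocks _).2 ⟨y', hy', hne', rfl⟩) hss.1)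
  refine ⟨𝓑.biUnion id, ?_, ?_⟩
  · refine (Finset.card_biUnion_le_card_mul _ _ L hL).trans ?_
    exact Nat.mul_le_mul_right L hcard
  · intro y hy hS
    by_contra hne
    -- An uncertified `y` would supply a minimal block disjoint from the whole family. Being
    -- nonempty, it is not a member, so it would enlarge the family.
    obtain ⟨B, hBle, hBmin⟩ := exists_minimal_le_of_wellFoundedLT (· ∈ blocks) (diff x y)
      ((hblocks _).2 ⟨y, hy, hne, rfl⟩)
    have hBS : ∀ B' ∈ 𝓑, Disjoint B B' := by
      intro B' hB'
      refine Finset.disjoint_left.2 fun i hi hi' => ?_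
      exact mem_diff.1 (hBle hi) (hS i (Finset.mem_biUnion.2 ⟨B', hB', hi'⟩)).symm
    have hBne : B.Nonempty := by
      rw [Finset.nonempty_iff_ne_empty]
      rintro rfl
      obtain ⟨y', _, hne', he⟩ := (hblocks _).1 hBmin.prop
      refine hne' (congrArg _ (funext fun i => ?_))
      by_contra hi
      exact absurd (mem_diff.2 (Ne.symm hi)) (by rw [he]; simp)
    have hBn : B ∉ 𝓑 := fun hB' => hBne.ne_empty (disjoint_self.1 (hBS B hB'))
    have hmem : insert B 𝓑 ∈ families := by
      simp only [families, Finset.mem_filter, Finset.mem_univ, true_and, Finset.mem_insert,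
        forall_eq_or_imp, Finset.coe_insert]
      refine ⟨?_, hBmin, hB⟩
      exact hdisj.insert fun B' hB' _ => hBS B' hB'
    have := hmax _ hmem
    rw [Finset.card_insert_of_notMem hBn] at this
    omega

/-- The number of occurrences of each symbol of `A` is within `w` of its target `c`. -/
def Window {n M : ℕ} (A : Finset (Fin M)) (c : Fin M → ℝ) (w : ℝ) (z : Fin n → Fin M) : Prop :=
  ∀ a ∈ A, |(cnt z a : ℝ) - c a| ≤ w

theorem diff_update_ssubset {n M : ℕ} {x y : Fin n → Fin M} {i : Fin n} (h : x i ≠ y i) :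
    diff x (Function.update y i (x i)) ⊂ diff x y := by
  refine (Finset.ssubset_iff_of_subset fun j hj => ?_).2 ⟨i, mem_diff.2 h, by simp [mem_diff]⟩
  rw [mem_diff] at hj ⊢
  by_cases hji : j = i
  · subst hji; exact h
  · rwa [Function.update_of_ne hji] at hj

theorem window_update {n M : ℕ} {A : Finset (Fin M)} {c : Fin M → ℝ} {w : ℝ} {y : Fin n → Fin M}
    (hy : Window A c w y) {i : Fin n} {b : Fin M}
    (h1 : y i ∈ A → y i ≠ b → c (y i) - w ≤ cnt y (y i) - 1)
    (h2 : b ∈ A → y i ≠ b → cnt y b + 1 ≤ c b + w) : Window A c w (Function.update y i b) := by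
  intro a ha
  rw [cnt_update]
  have hya := abs_le.1 (hy a ha)
  by_cases hia : y i = a <;> by_cases hba : b = a
  · simpa [hia, hba] using hy a ha
  · have := h1 (hia ▸ ha) (by rw [hia]; exact Ne.symm hba)
    rw [hia] at this
    simp only [hia, hba, if_true, if_false]
    exact abs_le.2 ⟨by linarith, by linarith⟩
  · have := h2 (hba ▸ ha) (by rw [hba]; exact hia)
    rw [hba] at this
    simp only [hia, hba, if_true, if_false]
    exact abs_le.2 ⟨by linarith, by linarith⟩
  · simpa [hia, hba] using hy a ha

/-- By minimality, resetting one entry of `y` to its value in `x` restores the side of `x`, so each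
such index is a sensitive singleton at `y`, provided the reset stays inside the window. The gap
between the windows `w` and `2 w` shows that `y` is not at the boundary, so all resets are allowed.
-/
theorem card_minimal_block_le {n M K : ℕ} {F : (Fin n → Fin M) → ℝ} (hF : HasQueryMass F K)
    {A : Finset (Fin M)} {c : Fin M → ℝ} {w : ℝ} (hw : 25 * (K : ℝ) + 2 ≤ w)
    {G : (Fin n → Fin M) → Prop} (hD : ∀ y, Window A c (2 * w) y → G y → Decided F y)
    {x : Fin n → Fin M} (hx : Window A c w x) (hG : ∀ y, G y → ∀ i, G (Function.update y i (x i)))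
    {y : Fin n → Fin M} (hy : Window A c (2 * w) y) (hGy : G y) (hne : side F y ≠ side F x)
    (hmin : ∀ y', Window A c (2 * w) y' → G y' → side F y' ≠ side F x → ¬ diff x y' ⊂ diff x y) :
    (diff x y).card ≤ 25 * K := by
  classical
  have hK : (0 : ℝ) ≤ K := Nat.cast_nonneg K
  have safe : ∀ P : Finset (Fin n), (∀ i ∈ P, x i ≠ y i) →
      (∀ i ∈ P, Window A c (2 * w) (Function.update y i (x i))) → P.card ≤ 25 * K := by
    intro P hP hsafe
    have h := card_sensitive_blocks_le hF (hD y hy hGy) (P.image fun i => {i}) ?_ ?_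
    · rwa [Finset.card_image_of_injective _ Finset.singleton_injective] at h
    · intro B hB B' hB' hBB'
      simp only [Finset.coe_image, Set.mem_image] at hB hB'
      obtain ⟨i, _, rfl⟩ := hB
      obtain ⟨j, _, rfl⟩ := hB'
      simpa [Function.onFun] using fun h : i = j => hBB' (by rw [h])
    · intro B hB
      obtain ⟨i, hi, rfl⟩ := Finset.mem_image.1 hB
      refine ⟨Function.update y i (x i), fun j hj => ?_,
        hD _ (hsafe i hi) (hG y hGy i), fun he => ?_⟩
      · rw [mem_diff] at hj
        by_contra hji
        exact hj (by rw [Function.update_of_ne (by simpa using hji)])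
      · exact hmin _ (hsafe i hi) (hG y hGy i) (he ▸ hne) (diff_update_ssubset (hP i hi))
  -- If the set `U` of symbols at the upper boundary were nonempty, `y` would have at least `w - 1`
  -- more entries in `U` than `x`. Resetting an entry from inside `U` to outside is safe, so `w - 1
  -- ≤ 25 K`, contrary to `hw`.
  have htop : ∀ a ∈ A, (cnt y a : ℝ) + 1 ≤ c a + 2 * w := by
    by_contra! hcon
    obtain ⟨a₀, ha₀, hlt₀⟩ := hcon
    let U := A.filter fun a => c a + 2 * w < (cnt y a : ℝ) + 1
    have hU : ∀ a, a ∈ U ↔ a ∈ A ∧ c a + 2 * w < (cnt y a : ℝ) + 1 := by simp [U]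
    have hterm : ∀ a ∈ U, w - 1 ≤ (cnt y a : ℝ) - cnt x a := by
      intro a ha
      have h1 := ((hU a).1 ha).2
      have h2 := abs_le.1 (hx a ((hU a).1 ha).1)
      linarith
    have h1 := sum_cnt_sub_le y x U
    have h2 := Finset.single_le_sum (f := fun a => (cnt y a : ℝ) - cnt x a)
      (fun a ha => by have := hterm a ha; change (0 : ℝ) ≤ cnt y a - cnt x a; linarith)
      ((hU a₀).2 ⟨ha₀, hlt₀⟩)
    have h3 := hterm a₀ ((hU a₀).2 ⟨ha₀, hlt₀⟩)
    have h4 := safe (Finset.univ.filter fun i => y i ∈ U ∧ x i ∉ U)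
      (fun i hi he => by
        simp only [Finset.mem_filter, Finset.mem_univ, true_and] at hi
        exact hi.2 (he ▸ hi.1))
      (fun i hi => by
        simp only [Finset.mem_filter, Finset.mem_univ, true_and] at hi
        refine window_update hy (fun _ _ => ?_) (fun hA _ => ?_)
        · have := ((hU _).1 hi.1).2
          linarith
        · by_contra! hlt
          exact hi.2 ((hU _).2 ⟨hA, hlt⟩))
    have h4' : ((Finset.univ.filter fun i => y i ∈ U ∧ x i ∉ U).card : ℝ) ≤ 25 * K := by
      exact_mod_cast h4
    linarith
  -- The mirror image, with resets into the set of symbols at the lower boundary; the upper side is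
  -- already covered by `htop`.
  have hbot : ∀ a ∈ A, c a - 2 * w ≤ (cnt y a : ℝ) - 1 := by
    by_contra! hcon
    obtain ⟨a₀, ha₀, hlt₀⟩ := hcon
    let U := A.filter fun a => (cnt y a : ℝ) - 1 < c a - 2 * w
    have hU : ∀ a, a ∈ U ↔ a ∈ A ∧ (cnt y a : ℝ) - 1 < c a - 2 * w := by simp [U]
    have hterm : ∀ a ∈ U, w - 1 ≤ (cnt x a : ℝ) - cnt y a := by
      intro a ha
      have h1 := ((hU a).1 ha).2
      have h2 := abs_le.1 (hx a ((hU a).1 ha).1)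
      linarith
    have h1 := sum_cnt_sub_le x y U
    have h2 := Finset.single_le_sum (f := fun a => (cnt x a : ℝ) - cnt y a)
      (fun a ha => by have := hterm a ha; change (0 : ℝ) ≤ cnt x a - cnt y a; linarith)
      ((hU a₀).2 ⟨ha₀, hlt₀⟩)
    have h3 := hterm a₀ ((hU a₀).2 ⟨ha₀, hlt₀⟩)
    have h4 := safe (Finset.univ.filter fun i => x i ∈ U ∧ y i ∉ U)
      (fun i hi he => by
        simp only [Finset.mem_filter, Finset.mem_univ, true_and] at hi
        exact hi.2 (he ▸ hi.1))
      (fun i hi => by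
        simp only [Finset.mem_filter, Finset.mem_univ, true_and] at hi
        refine window_update hy (fun hA _ => ?_) (fun hA _ => htop _ hA)
        by_contra! hlt
        exact hi.2 ((hU _).2 ⟨hA, hlt⟩))
    have h4' : ((Finset.univ.filter fun i => x i ∈ U ∧ y i ∉ U).card : ℝ) ≤ 25 * K := by
      exact_mod_cast h4
    linarith
  exact safe _ (fun i hi => mem_diff.1 hi) fun i _ =>
    window_update hy (fun hA _ => hbot _ hA) (fun hA _ => htop _ hA)

theorem exists_window_certificate {n M K : ℕ} {F : (Fin n → Fin M) → ℝ} (hF : HasQueryMass F K)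
    {A : Finset (Fin M)} {c : Fin M → ℝ} {w : ℝ} (hw : 25 * (K : ℝ) + 2 ≤ w)
    {G : (Fin n → Fin M) → Prop} (hD : ∀ y, Window A c (2 * w) y → G y → Decided F y)
    {x : Fin n → Fin M} (hx : Window A c w x) (hGx : G x)
    (hG : ∀ y, G y → ∀ i, G (Function.update y i (x i))) :
    ∃ S : Finset (Fin n), S.card ≤ 25 * K * (25 * K) ∧
      ∀ y, Window A c (2 * w) y → G y → (∀ i ∈ S, y i = x i) → side F y = side F x := by
  have hw0 : 0 ≤ w := by
    have : (0 : ℝ) ≤ K := Nat.cast_nonneg K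
    linarith
  have hx2 : Window A c (2 * w) x := fun a ha => (hx a ha).trans (by linarith)
  obtain ⟨S, hS, h⟩ := exists_certificate hF {y | Window A c (2 * w) y ∧ G y}
    (fun y hy => hD y hy.1 hy.2) (x := x) ⟨hx2, hGx⟩ (L := 25 * K)
    (fun y hy hne hmin => card_minimal_block_le hF hw hD hx hG hy.1 hy.2 hne
      fun y' h1 h2 => hmin y' ⟨h1, h2⟩)
  exact ⟨S, hS, fun y h1 h2 => h y ⟨h1, h2⟩⟩


/-! ### Inputs of nearly known type -/

/-- A description `c` of symbol frequencies up to precision `w`: the symbols of `A` occur at least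
`G` times, `star` occurs most often, the remaining ones are rare. -/
structure Profile {M : ℕ} (n K : ℕ) (c : Fin M → ℝ) (w G : ℝ) (A : Finset (Fin M)) (star : Fin M) :
    Prop where
  sum_eq : ∑ a, c a = n
  star_notMem : star ∉ A
  common : ∀ a ∈ A, G ≤ c a
  rare : ∀ a, a ≠ star → a ∉ A → c a ≤ G
  star_large : (n : ℝ) / M ≤ c star
  G_nonneg : 0 ≤ G
  K_pos : 0 < K
  w_le : 3 * w ≤ 1 / (225 * K) * (G - 2 * w)
  G_le : M * (G + 3 * w) ≤ 1 / (225 * K) * (n / (2 * M))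
  w_le_star : 2 * M * w ≤ n / (2 * M)
  le_w : ((25 * K * (25 * K) : ℕ) : ℝ) + 2 ≤ w

theorem Profile.w_pos {n M K : ℕ} {c : Fin M → ℝ} {w G : ℝ} {A : Finset (Fin M)} {star : Fin M}
    (h : Profile n K c w G A star) : 0 < w := by
  have := h.le_w
  have h0 : (0 : ℝ) ≤ ((25 * K * (25 * K) : ℕ) : ℝ) := Nat.cast_nonneg _
  linarith

/-- `z` has at most as many occurrences of each rare symbol as `t`. -/
def RareLE {n M : ℕ} (A : Finset (Fin M)) (star : Fin M) (z t : Fin n → Fin M) : Prop :=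
  ∀ a, a ≠ star → a ∉ A → cnt z a ≤ cnt t a

/-- This is the hypothesis of `exists_cheap_perm` with `p = 1 / (225 K)`. A common symbol has
surplus at most `3 w`, small against its count; a rare one has none; the surplus of `star` equals
the total deficit of the others, small against its count of at least `n / (2 M)`. -/
theorem cnt_sub_cnt_le_of_rareLE {n M K : ℕ} {c : Fin M → ℝ} {w G : ℝ} {A : Finset (Fin M)}
    {star : Fin M} (h : Profile n K c w G A star) {z t : Fin n → Fin M}
    (ht : ∀ a, |(cnt t a : ℝ) - c a| ≤ w) (hz : Window A c (2 * w) z)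
    (hzt : RareLE A star z t) (a : Fin M) :
    (cnt z a : ℝ) - cnt t a ≤ 1 / (225 * K) * cnt z a := by
  have hw := h.w_pos
  have hK : (0 : ℝ) < K := Nat.cast_pos.2 h.K_pos
  have hp : (0 : ℝ) < 1 / (225 * K) := by positivity
  have hMpos : (0 : ℝ) < M := Nat.cast_pos.2 (by have := star.2; omega)
  by_cases haA : a ∈ A
  · have h1 := abs_le.1 (ht a)
    have h2 := abs_le.1 (hz a haA)
    have h3 := h.common a haA
    have h4 := h.w_le
    have h5 : 1 / (225 * (K : ℝ)) * (G - 2 * w) ≤ 1 / (225 * K) * cnt z a :=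
      mul_le_mul_of_nonneg_left (by linarith) hp.le
    linarith
  by_cases hs : a = star
  · subst hs
    have hcard : ((Finset.univ.erase a).card : ℝ) ≤ M := by
      rw [Finset.card_erase_of_mem (Finset.mem_univ a), Finset.card_univ, Fintype.card_fin]
      exact_mod_cast Nat.sub_le _ _
    have e1 := Finset.add_sum_erase _ (fun b => (cnt z b : ℝ)) (Finset.mem_univ a)
    have e2 := Finset.add_sum_erase _ (fun b => (cnt t b : ℝ)) (Finset.mem_univ a)
    have e3 := Finset.add_sum_erase _ c (Finset.mem_univ a)
    rw [sum_cnt] at e1 e2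
    rw [h.sum_eq] at e3
    have h1 : ∑ b ∈ Finset.univ.erase a, (cnt t b : ℝ) - ∑ b ∈ Finset.univ.erase a, (cnt z b : ℝ) ≤
        M * (G + 3 * w) := by
      rw [← Finset.sum_sub_distrib]
      refine (Finset.sum_le_card_nsmul _ _ (G + 3 * w) fun b hb => ?_).trans ?_
      · have h2 := abs_le.1 (ht b)
        by_cases hbA : b ∈ A
        · have h3 := abs_le.1 (hz b hbA)
          linarith [h.G_nonneg]
        · have h3 := h.rare b (Finset.ne_of_mem_erase hb) hbA
          linarith [(Nat.cast_nonneg (cnt z b) : (0 : ℝ) ≤ _)]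
      · rw [nsmul_eq_mul]
        exact mul_le_mul_of_nonneg_right hcard (by linarith [h.G_nonneg])
    have h2 : ∑ b ∈ Finset.univ.erase a, (cnt z b : ℝ) - ∑ b ∈ Finset.univ.erase a, c b ≤
        M * (2 * w) := by
      rw [← Finset.sum_sub_distrib]
      refine (Finset.sum_le_card_nsmul _ _ (2 * w) fun b hb => ?_).trans ?_
      · by_cases hbA : b ∈ A
        · exact (abs_le.1 (hz b hbA)).2
        · have h3 : (cnt z b : ℝ) ≤ cnt t b := by
            exact_mod_cast hzt b (Finset.ne_of_mem_erase hb) hbA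
          have h2 := abs_le.1 (ht b)
          linarith
      · rw [nsmul_eq_mul]
        exact mul_le_mul_of_nonneg_right hcard (by linarith)
    have h3 := h.star_large
    have h4 := h.w_le_star
    have h5 : (n : ℝ) / M = n / (2 * M) + n / (2 * M) := by field_simp; ring
    have h6 : (n : ℝ) / (2 * M) ≤ cnt z a := by linarith
    have h7 := mul_le_mul_of_nonneg_left h6 hp.le
    linarith [h.G_le]
  · have h1 : (cnt z a : ℝ) ≤ cnt t a := by exact_mod_cast hzt a hs haA
    have h2 : 0 ≤ 1 / (225 * (K : ℝ)) * cnt z a := by positivity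
    linarith

theorem decided_of_rareLE {n M K : ℕ} {F : (Fin n → Fin M) → ℝ} (hF : HasQueryMass F K)
    {c : Fin M → ℝ} {w G : ℝ} {A : Finset (Fin M)} {star : Fin M}
    (h : Profile n K c w G A star) {z t : Fin n → Fin M}
    (hFt : ∀ σ : Equiv.Perm (Fin n), F (fun i => t (σ i)) < 1 / 3 ∨ 2 / 3 < F (fun i => t (σ i)))
    (ht : ∀ a, |(cnt t a : ℝ) - c a| ≤ w) (hz : Window A c (2 * w) z)
    (hzt : RareLE A star z t) : Decided F z := by
  have hK : (0 : ℝ) < K := Nat.cast_pos.2 h.K_pos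
  have hp : (0 : ℝ) < 1 / (225 * K) := by positivity
  obtain ⟨ν, hν, hsum, hle⟩ := hF z
  obtain ⟨σ, hσ⟩ := exists_cheap_perm z t ν hν hp.le (cnt_sub_cnt_le_of_rareLE h ht hz hzt)
  have h1 := (hle _).trans (hσ.trans (mul_le_mul_of_nonneg_left hsum hp.le))
  -- The deviation `1/15` is exactly the distance from `1/3` to `2/5` and from `2/3` to `3/5`.
  have h2 : 1 / (225 * (K : ℝ)) * K = (1 / 15) ^ 2 := by field_simp; norm_num
  rw [h2] at h1
  have h3 := abs_le.1 (abs_le_of_sq_le_sq h1 (by norm_num))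
  rcases hFt σ with h4 | h4
  · exact Or.inl (by linarith)
  · exact Or.inr (by linarith)

theorem rareLE_of_forall {n M : ℕ} {A : Finset (Fin M)} {star : Fin M} {z t : Fin n → Fin M}
    (h : ∀ i, z i ≠ star → z i ∉ A → z i = t i) : RareLE A star z t := by
  intro a ha haA
  refine Finset.card_le_card fun i hi => ?_
  simp only [Finset.mem_filter, Finset.mem_univ, true_and] at hi ⊢
  rw [← h i (hi ▸ ha) (hi ▸ haA), hi]

/-- A rule that, from the entries `u` read at the indices `P`, proposes a few further indices to
read together with a guess for the value: whenever the guess is wrong, the indices contain a new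
element of a fixed small set that depends on the input only. -/
theorem exists_proposal {n M K : ℕ} {F : (Fin n → Fin M) → ℝ} (hF : HasQueryMass F K)
    {c : Fin M → ℝ} {w G : ℝ} {A : Finset (Fin M)} {star : Fin M}
    (h : Profile n K c w G A star) {X : Set (Fin n → Fin M)} (hX : IsSymmetric X)
    (hFX : ∀ x ∈ X, F x < 1 / 3 ∨ 2 / 3 < F x) :
    ∃ pick : Finset (Fin n) → (Fin n → Fin M) → Finset (Fin n) × Bool,
      (∀ P u, (pick P u).1.card ≤ 25 * K * (25 * K)) ∧
      ∀ y ∈ X, (∀ a, |(cnt y a : ℝ) - c a| ≤ w) →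
        ∃ S : Finset (Fin n), S.card ≤ 25 * K * (25 * K) ∧
          ∀ P u, (∀ i ∈ P, u i = y i) → (pick P u).2 ≠ side F y →
            ∃ i ∈ (pick P u).1, i ∈ S ∧ i ∉ P := by
  classical
  have hw := h.w_pos
  have hw25 : 25 * (K : ℝ) + 2 ≤ w := by
    refine le_trans ?_ h.le_w
    have : 25 * K ≤ 25 * K * (25 * K) := Nat.le_mul_of_pos_right _ (by have := h.K_pos; omega)
    have : (25 * K : ℝ) ≤ ((25 * K * (25 * K) : ℕ) : ℝ) := by exact_mod_cast this
    linarith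
  let near : (Fin n → Fin M) → Prop := fun z =>
    ∃ t ∈ X, (∀ a, |(cnt t a : ℝ) - c a| ≤ w) ∧ RareLE A star z t
  have hdec : ∀ z, Window A c (2 * w) z → near z → Decided F z := by
    rintro z hz ⟨t, htX, ht, hzt⟩
    exact decided_of_rareLE hF h (fun σ => hFX _ (hX t htX σ)) ht hz hzt
  -- Requiring all rare symbols of a candidate to lie in `P` makes `near` stable under copying its
  -- entries: outside `P` this can only introduce common symbols or `star`.
  let Cand : Finset (Fin n) → (Fin n → Fin M) → (Fin n → Fin M) → Prop := fun P u x =>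
    Window A c w x ∧ near x ∧ (∀ i ∈ P, x i = u i) ∧ ∀ i, x i ≠ star → x i ∉ A → i ∈ P
  have key : ∀ P u, ∃ r : Finset (Fin n) × Bool, r.1.card ≤ 25 * K * (25 * K) ∧
      ((∃ x, Cand P u x) → ∃ x, Cand P u x ∧ r.2 = side F x ∧
        ∀ y, Window A c (2 * w) y → (near y ∧ ∀ i ∈ P, y i = u i) →
          (∀ i ∈ r.1, y i = x i) → side F y = side F x) := by
    intro P u
    by_cases hex : ∃ x, Cand P u x
    · obtain ⟨x, hx⟩ := hex
      obtain ⟨hx1, hx2, hx3, hx4⟩ := hx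
      obtain ⟨S, hS, hcert⟩ := exists_window_certificate hF hw25
        (G := fun y => near y ∧ ∀ i ∈ P, y i = u i) (fun y h1 h2 => hdec y h1 h2.1) hx1
        ⟨hx2, hx3⟩ (by
          rintro y ⟨⟨t, htX, ht, hyt⟩, hyP⟩ i
          have hP : ∀ j ∈ P, Function.update y i (x i) j = u j := by
            intro j hj
            by_cases hji : j = i
            · subst hji; rw [Function.update_self, hx3 j hj]
            · rw [Function.update_of_ne hji, hyP j hj]
          refine ⟨⟨t, htX, ht, fun a ha haA => ?_⟩, hP⟩
          by_cases hiP : i ∈ P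
          · have : Function.update y i (x i) = y := by
              rw [hx3 i hiP, ← hyP i hiP, Function.update_eq_self]
            rw [this]
            exact hyt a ha haA
          · have hxa : x i ≠ a := by
              rintro rfl
              exact hiP (hx4 i ha haA)
            refine le_trans ?_ (hyt a ha haA)
            have h1 := cnt_update y i (x i) a
            rw [if_neg hxa] at h1
            have h2 : (cnt (Function.update y i (x i)) a : ℝ) ≤ cnt y a := by
              rw [h1]; split_ifs <;> linarith
            exact_mod_cast h2)
      exact ⟨(S, side F x), hS, fun _ => ⟨x, ⟨hx1, hx2, hx3, hx4⟩, rfl, hcert⟩⟩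
    · exact ⟨(∅, true), by simp, fun h' => absurd h' hex⟩
  choose pick hpick1 hpick2 using key
  refine ⟨pick, hpick1, fun y hyX hy => ?_⟩
  have hyW : Window A c w y := fun a _ => hy a
  have hnear : ∀ z, (∀ i, z i ≠ star → z i ∉ A → z i = y i) → near z := fun z hz =>
    ⟨y, hyX, hy, rareLE_of_forall hz⟩
  -- The certificate of the true input `y`, valid among inputs whose rare symbols all sit where `y`
  -- has them.
  obtain ⟨S, hS, hcert⟩ := exists_window_certificate hF hw25
    (G := fun z => ∀ i, z i ≠ star → z i ∉ A → z i = y i)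
    (fun z h1 h2 => hdec z h1 (hnear z h2)) hyW (fun _ _ _ => rfl) (by
      intro z hz i j h1 h2
      by_cases hji : j = i
      · subst hji; simp
      · rw [Function.update_of_ne hji] at h1 h2 ⊢
        exact hz j h1 h2)
  refine ⟨S, hS, fun P u hu hne => ?_⟩
  have hcand : ∃ x, Cand P u x := by
    -- The true input yields a candidate once its unread rare entries are replaced by `star`; no
    -- count of a symbol in `A` changes.
    let x : Fin n → Fin M := fun i => if y i ≠ star ∧ y i ∉ A ∧ i ∉ P then star else y i
    have hxy : ∀ i, x i ≠ star → x i = y i := by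
      intro i hi
      by_cases hc : y i ≠ star ∧ y i ∉ A ∧ i ∉ P
      · simp only [x, if_pos hc] at hi
        exact absurd rfl hi
      · simp only [x, if_neg hc]
    refine ⟨x, fun a ha => ?_, hnear x fun i h1 _ => hxy i h1, fun i hi => ?_, fun i h1 h2 => ?_⟩
    · have : cnt x a = cnt y a := by
        refine congrArg Finset.card (Finset.filter_congr fun i _ => ?_)
        by_cases hc : y i ≠ star ∧ y i ∉ A ∧ i ∉ P
        · simp only [x, if_pos hc]
          exact ⟨fun h' => absurd (h' ▸ ha) h.star_notMem, fun h' => absurd (h' ▸ ha) hc.2.1⟩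
        · simp only [x, if_neg hc]
      rw [this]
      exact hyW a ha
    · have hc : ¬ (y i ≠ star ∧ y i ∉ A ∧ i ∉ P) := fun hc => hc.2.2 hi
      simp only [x, if_neg hc]
      exact (hu i hi).symm
    · by_contra hiP
      have h3 := hxy i h1
      rw [h3] at h1 h2
      have hc : y i ≠ star ∧ y i ∉ A ∧ i ∉ P := ⟨h1, h2, hiP⟩
      simp only [x, if_pos hc] at h3
      exact h1 h3.symm
  obtain ⟨x, ⟨hx1, _, hx3, hx4⟩, hb, hxcert⟩ := hpick2 P u hcand
  by_contra! hcon
  have hxyP : ∀ i ∈ P, x i = y i := fun i hi => (hx3 i hi).trans (hu i hi)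
  -- If the proposed indices met `S` only inside `P`, this hybrid would satisfy both certificates.
  -- Changing at most `S.card ≤ w` entries of `x` explains the window `2 w`.
  let z : Fin n → Fin M := fun i => if i ∈ S then y i else x i
  have hzG : ∀ i, z i ≠ star → z i ∉ A → z i = y i := by
    intro i h1 h2
    by_cases hi : i ∈ S
    · simp only [z, if_pos hi]
    · simp only [z, if_neg hi] at h1 h2 ⊢
      exact hxyP i (hx4 i h1 h2)
  have hzW : Window A c (2 * w) z := by
    intro a ha
    have h1 : cnt z a ≤ cnt x a + S.card :=
      cnt_le_cnt_add_card (fun i hi => by simp only [z, if_neg hi]) a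
    have h2 : cnt x a ≤ cnt z a + S.card :=
      cnt_le_cnt_add_card (fun i hi => by simp only [z, if_neg hi]) a
    have h1' : (cnt z a : ℝ) ≤ cnt x a + S.card := by exact_mod_cast h1
    have h2' : (cnt x a : ℝ) ≤ cnt z a + S.card := by exact_mod_cast h2
    have h3 : (S.card : ℝ) ≤ ((25 * K * (25 * K) : ℕ) : ℝ) := by exact_mod_cast hS
    have h4 := h.le_w
    have h5 := abs_le.1 (hx1 a ha)
    exact abs_le.2 ⟨by linarith, by linarith⟩
  have hzP : ∀ i ∈ P, z i = u i := by
    intro i hi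
    by_cases hiS : i ∈ S
    · simp only [z, if_pos hiS]; exact (hu i hi).symm
    · simp only [z, if_neg hiS]; exact hx3 i hi
  have e1 := hcert z hzW hzG fun i hi => by simp only [z, if_pos hi]
  have e2 := hxcert z hzW ⟨hnear z hzG, hzP⟩ fun i hi => by
    by_cases hiS : i ∈ S
    · simp only [z, if_pos hiS]
      exact (hxyP i (hcon i hi hiS)).symm
    · simp only [z, if_neg hiS]
  exact hne (by rw [hb, ← e2, e1])


/-! ### Building decision trees -/

namespace DecisionTree

/-- Query the indices of a list, overwriting the corresponding entries of `u` by the answers, and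
continue with `k`. -/
def queryAll {n M : ℕ} : List (Fin n) → (Fin n → Fin M) →
    ((Fin n → Fin M) → DecisionTree n M) → DecisionTree n M
  | [], u, k => k u
  | i :: l, u, k => query i fun a => queryAll l (Function.update u i a) k

theorem eval_queryAll {n M : ℕ} (l : List (Fin n)) (u : Fin n → Fin M)
    (k : (Fin n → Fin M) → DecisionTree n M) (y : Fin n → Fin M) :
    (queryAll l u k).eval y = (k fun i => if i ∈ l then y i else u i).eval y := by
  induction l generalizing u with
  | nil => simp [queryAll]
  | cons i l ih =>
    rw [queryAll, eval, ih]
    congr 2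
    funext j
    by_cases hj : j ∈ l
    · simp [hj]
    · by_cases hji : j = i
      · subst hji; simp [hj]
      · simp [hj, hji]

theorem depth_queryAll_le {n M : ℕ} (l : List (Fin n)) (u : Fin n → Fin M)
    {k : (Fin n → Fin M) → DecisionTree n M} {d : ℕ} (hk : ∀ u, (k u).depth ≤ d) :
    (queryAll l u k).depth ≤ l.length + d := by
  induction l generalizing u with
  | nil => simpa [queryAll] using hk u
  | cons i l ih =>
    rw [queryAll, depth, List.length_cons]
    have : (Finset.univ.sup fun a => (queryAll l (Function.update u i a) k).depth) ≤
        l.length + d := Finset.sup_le fun a _ => ih _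
    omega

/-- In each of `m` rounds read the proposed indices and add the guess to the score; output the
sign of the score. -/
noncomputable def vote {n M : ℕ}
    (pick : Finset (Fin n) → (Fin n → Fin M) → Finset (Fin n) × Bool) :
    ℕ → Finset (Fin n) → (Fin n → Fin M) → ℤ → DecisionTree n M
  | 0, _, _, s => leaf (decide (0 < s))
  | m + 1, P, u, s => queryAll (pick P u).1.toList u fun u' =>
      vote pick m (P ∪ (pick P u).1) u' (s + if (pick P u).2 then 1 else -1)

theorem depth_vote_le {n M C : ℕ}
    {pick : Finset (Fin n) → (Fin n → Fin M) → Finset (Fin n) × Bool}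
    (hpick : ∀ P u, (pick P u).1.card ≤ C) (m : ℕ) (P : Finset (Fin n)) (u : Fin n → Fin M)
    (s : ℤ) : (vote pick m P u s).depth ≤ m * C := by
  induction m generalizing P u s with
  | zero => simp [vote, depth]
  | succ m ih =>
    rw [vote]
    refine (depth_queryAll_le _ _ fun u' => ih _ u' _).trans ?_
    rw [Finset.length_toList, add_mul, one_mul, add_comm]
    exact Nat.add_le_add_left (hpick P u) _

/-- A wrong guess moves the score by one against `v` but uses up an element of `S`, so the potential
inequality `hs` survives each round and ends with a score of the right sign. From score 0, `2 |S| +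
1` rounds suffice. -/
theorem eval_vote {n M : ℕ} {pick : Finset (Fin n) → (Fin n → Fin M) → Finset (Fin n) × Bool}
    {y : Fin n → Fin M} {v : Bool} {S : Finset (Fin n)}
    (hS : ∀ P u, (∀ i ∈ P, u i = y i) → (pick P u).2 ≠ v →
      ∃ i ∈ (pick P u).1, i ∈ S ∧ i ∉ P)
    (m : ℕ) (P : Finset (Fin n)) (u : Fin n → Fin M) (s : ℤ) (hu : ∀ i ∈ P, u i = y i)
    (hs : 1 + 2 * ((S \ P).card : ℤ) ≤ (if v then s else -s) + m) :
    (vote pick m P u s).eval y = v := by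
  induction m generalizing P u s with
  | zero =>
    rw [vote, eval]
    cases v <;> simp at hs ⊢ <;> omega
  | succ m ih =>
    rw [vote, eval_queryAll]
    refine ih _ _ _ (fun i hi => ?_) ?_
    · by_cases h : i ∈ (pick P u).1
      · simp [h]
      · have hiP : i ∈ P := by simpa [h] using hi
        simp [h, hu i hiP]
    · have hsub : S \ (P ∪ (pick P u).1) ⊆ S \ P :=
        Finset.sdiff_subset_sdiff subset_rfl Finset.subset_union_left
      have hle := Finset.card_le_card hsub
      push_cast at hs
      by_cases hb : (pick P u).2 = v
      · rw [hb]
        cases v <;> simp at hs ⊢ <;> omega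
      · obtain ⟨i, hi, hiS, hiP⟩ := hS P u hu hb
        have hlt : (S \ (P ∪ (pick P u).1)).card < (S \ P).card := by
          refine Finset.card_lt_card ((Finset.ssubset_iff_of_subset hsub).2 ⟨i, ?_, ?_⟩)
          · simp [hiS, hiP]
          · simp [hi]
        have hb' : (pick P u).2 = !v := by
          cases v <;> simpa using hb
        rw [hb']
        cases v <;> simp at hs ⊢ <;> omega

end DecisionTree

theorem randomizedComputable_of_family {n M q : ℕ} {X : Set (Fin n → Fin M)} {f : X → Bool}
    {Ω : Type} [Fintype Ω] [Nonempty Ω] (T : Ω → DecisionTree n M) (hT : ∀ ω, (T ω).depth ≤ q)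
    (h : ∀ x : X, 3 * (Finset.univ.filter fun ω => (T ω).eval x.1 ≠ f x).card < Fintype.card Ω) :
    RandomizedComputable f q := by
  refine ⟨(PMF.uniformOfFintype Ω).map T, ?_, fun x => ?_⟩
  · intro t ht
    obtain ⟨ω, _, rfl⟩ := (PMF.mem_support_map_iff _ _ _).1 ht
    exact hT ω
  · rw [PMF.map_comp, PMF.map_apply, tsum_fintype]
    refine lt_of_eq_of_lt (Finset.sum_congr rfl (g := fun ω =>
      if (T ω).eval x.1 ≠ f x then (Fintype.card Ω : ENNReal)⁻¹ else 0) fun ω _ => ?_) ?_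
    · rw [PMF.uniformOfFintype_apply]
      cases hfx : f x <;> cases hTx : (T ω).eval x.1 <;> simp [hTx]
    rw [← Finset.sum_filter, Finset.sum_const, nsmul_eq_mul, ← div_eq_mul_inv]
    have h3 := h x
    have hpos : 0 < Fintype.card Ω := Fintype.card_pos
    rw [ENNReal.div_lt_iff (Or.inl (by exact_mod_cast hpos.ne')) (Or.inl (by simp)),
      mul_comm, ← div_eq_mul_one_div, ENNReal.lt_div_iff_mul_lt (Or.inl (by simp))
        (Or.inl (by simp)), mul_comm]
    exact_mod_cast h3

theorem randomizedComputable_of_tree {n M q : ℕ} {X : Set (Fin n → Fin M)} {f : X → Bool}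
    (T : DecisionTree n M) (hT : T.depth ≤ q) (h : ∀ x : X, T.eval x.1 = f x) :
    RandomizedComputable f q :=
  randomizedComputable_of_family (Ω := Unit) (fun _ => T) (fun _ => hT) fun x => by simp [h x]

theorem randomizedComputable_self {n M : ℕ} (hM : 0 < M) {X : Set (Fin n → Fin M)}
    (f : X → Bool) : RandomizedComputable f n := by
  classical
  refine randomizedComputable_of_tree (DecisionTree.queryAll (List.finRange n) (fun _ => ⟨0, hM⟩)
    fun u => .leaf (if h : u ∈ X then f ⟨u, h⟩ else false)) ?_ fun x => ?_
  · refine (DecisionTree.depth_queryAll_le (d := 0) _ _ fun u => ?_).trans (by simp)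
    simp [DecisionTree.depth]
  · rw [DecisionTree.eval_queryAll]
    simp [DecisionTree.eval]

/-! ### Estimating the type by sampling -/

/-- The variance of a sum of independent centred samples: the cross terms vanish by `hg`. -/
theorem sum_sq_sum_sample_le {n : ℕ} (g : Fin n → ℝ) (hg : ∑ i, g i = 0) (hg1 : ∀ i, |g i| ≤ 1)
    (s : ℕ) : ∑ ω : Fin s → Fin n, (∑ j, g (ω j)) ^ 2 ≤ s * (n : ℝ) ^ s := by
  induction s with
  | zero => simp
  | succ s ih =>
    rw [← (Fin.consEquiv fun _ : Fin (s + 1) => Fin n).sum_comp, Fintype.sum_prod_type]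
    have e : ∀ (i : Fin n) (ω : Fin s → Fin n),
        (∑ j, g ((Fin.consEquiv fun _ : Fin (s + 1) => Fin n) (i, ω) j)) ^ 2 =
        g i ^ 2 + 2 * (g i * ∑ j, g (ω j)) + (∑ j, g (ω j)) ^ 2 := by
      intro i ω
      rw [Fin.sum_univ_succ]
      simp only [Fin.consEquiv_apply, Fin.cons_zero, Fin.cons_succ]
      ring
    simp only [e, Finset.sum_add_distrib, ← Finset.mul_sum, ← Finset.sum_mul, hg, zero_mul,
      mul_zero, add_zero, Finset.sum_const, Finset.card_univ, Fintype.card_fin, nsmul_eq_mul,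
      Fintype.card_pi, Finset.prod_const]
    have h1 : ∑ i, g i ^ 2 ≤ n := by
      refine (Finset.sum_le_sum (g := fun _ => (1 : ℝ)) fun i _ => ?_).trans (by simp)
      have := hg1 i
      rw [← sq_abs]
      exact pow_le_one₀ (abs_nonneg _) this
    have hn : (0 : ℝ) ≤ n := Nat.cast_nonneg n
    push_cast
    have h2 := mul_le_mul_of_nonneg_left h1 (pow_nonneg hn s)
    have h3 := mul_le_mul_of_nonneg_left ih hn
    rw [pow_succ]
    linarith

/-- Chebyshev's inequality, as a count of samples: an error above `n / E` in the estimated count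
means that the centred sum exceeds `s / E`. -/
theorem card_bad_symbol_le {n M : ℕ} (hn : 0 < n) (y : Fin n → Fin M) (a : Fin M) {s E : ℕ}
    (hs : 0 < s) (hE : 0 < E) :
    ((Finset.univ.filter fun ω : Fin s → Fin n =>
      ¬ |(cnt y a : ℝ) - n / s * cnt (fun j => y (ω j)) a| ≤ n / E).card : ℝ) * s ≤
      E ^ 2 * (n : ℝ) ^ s := by
  have hn' : (0 : ℝ) < n := Nat.cast_pos.2 hn
  have hs' : (0 : ℝ) < s := Nat.cast_pos.2 hs
  have hE' : (0 : ℝ) < E := Nat.cast_pos.2 hE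
  let g : Fin n → ℝ := fun i => (if y i = a then 1 else 0) - cnt y a / n
  have hcnt : ∀ {k : ℕ} (z : Fin k → Fin M), ∑ j, (if z j = a then (1 : ℝ) else 0) = cnt z a := by
    intro k z
    rw [cnt, Finset.card_filter]
    push_cast
    rfl
  have hle : (cnt y a : ℝ) ≤ n := by
    have : cnt y a ≤ n := (Finset.card_le_univ _).trans (by simp)
    exact_mod_cast this
  have hg : ∑ i, g i = 0 := by
    simp only [g, Finset.sum_sub_distrib, hcnt, Finset.sum_const, Finset.card_univ,
      Fintype.card_fin, nsmul_eq_mul]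
    field_simp
    ring
  have hg1 : ∀ i, |g i| ≤ 1 := by
    intro i
    have h1 : (cnt y a : ℝ) / n ≤ 1 := (div_le_one hn').2 hle
    have h0 : 0 ≤ (cnt y a : ℝ) / n := by positivity
    simp only [g]
    split_ifs <;> exact abs_le.2 ⟨by linarith, by linarith⟩
  have hsum : ∀ ω : Fin s → Fin n,
      ∑ j, g (ω j) = (s : ℝ) / n * (n / s * cnt (fun j => y (ω j)) a - cnt y a) := by
    intro ω
    simp only [g, Finset.sum_sub_distrib, hcnt (fun j => y (ω j)), Finset.sum_const,
      Finset.card_univ, Fintype.card_fin, nsmul_eq_mul]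
    field_simp
  have hbad : ∀ ω ∈ Finset.univ.filter fun ω : Fin s → Fin n =>
      ¬ |(cnt y a : ℝ) - n / s * cnt (fun j => y (ω j)) a| ≤ n / E,
      ((s : ℝ) / E) ^ 2 ≤ (∑ j, g (ω j)) ^ 2 := by
    intro ω hω
    have hω' := not_le.1 (Finset.mem_filter.1 hω).2
    rw [hsum, ← sq_abs (_ * _), abs_mul, abs_of_pos (div_pos hs' hn'), abs_sub_comm]
    refine pow_le_pow_left₀ (by positivity) ?_ 2
    calc (s : ℝ) / E = s / n * (n / E) := by field_simp
      _ ≤ _ := mul_le_mul_of_nonneg_left hω'.le (by positivity)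
  have h1 := Finset.card_nsmul_le_sum _ _ _ hbad
  rw [nsmul_eq_mul] at h1
  have h2 := h1.trans ((Finset.sum_le_sum_of_subset_of_nonneg (Finset.filter_subset _ _)
    fun _ _ _ => sq_nonneg _).trans (sum_sq_sum_sample_le g hg hg1 s))
  rw [div_pow, ← mul_div_assoc, div_le_iff₀ (by positivity)] at h2
  refine le_of_mul_le_mul_left ?_ hs'
  linarith

theorem three_mul_card_bad_lt {n M : ℕ} (hn : 0 < n) (y : Fin n → Fin M) {s E : ℕ} (hE : 0 < E)
    (hs : 3 * M * E ^ 2 < s) :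
    3 * (Finset.univ.filter fun ω : Fin s → Fin n =>
      ¬ ∀ a, |(cnt y a : ℝ) - n / s * cnt (fun j => y (ω j)) a| ≤ n / E).card < n ^ s := by
  classical
  have hs0 : 0 < s := by omega
  let bad : Fin M → Finset (Fin s → Fin n) := fun a => Finset.univ.filter fun ω =>
    ¬ |(cnt y a : ℝ) - n / s * cnt (fun j => y (ω j)) a| ≤ n / E
  have hsub : (Finset.univ.filter fun ω : Fin s → Fin n =>
      ¬ ∀ a, |(cnt y a : ℝ) - n / s * cnt (fun j => y (ω j)) a| ≤ n / E) ⊆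
      Finset.univ.biUnion bad := by
    intro ω hω
    simp only [Finset.mem_filter, Finset.mem_univ, true_and, not_forall] at hω
    simpa [bad] using hω
  have h1 := (Finset.card_le_card hsub).trans Finset.card_biUnion_le
  have h2 : (∑ a, (bad a).card) * s ≤ M * (E ^ 2 * n ^ s) := by
    rw [Finset.sum_mul]
    refine (Finset.sum_le_card_nsmul _ _ (E ^ 2 * n ^ s) fun a _ => ?_).trans (by simp)
    have := card_bad_symbol_le hn y a hs0 hE
    exact_mod_cast this
  have hpos : 0 < n ^ s := pow_pos hn s
  have h3 := Nat.mul_le_mul_right s h1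
  refine lt_of_mul_lt_mul_right (a := s) ?_ (Nat.zero_le s)
  calc _ ≤ 3 * (M * (E ^ 2 * n ^ s)) := by
        rw [mul_assoc]
        exact Nat.mul_le_mul_left 3 (h3.trans h2)
    _ = 3 * M * E ^ 2 * n ^ s := by ring
    _ < s * n ^ s := Nat.mul_lt_mul_of_pos_right hs hpos
    _ = n ^ s * s := mul_comm _ _

/-! ### The randomized algorithm -/

/-- By averaging, some symbol has frequency at least `n / M` and serves as `star`. The threshold `n
/ (1000 M² K)` lies about a factor `K` below `n / M` and a factor `K` above the precision `n / E`,
as the relative accuracy `1 / (225 K)` demands on both sides. -/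
theorem exists_profile {n M K E : ℕ} (hM : 0 < M) (hK : 0 < K) (hE : E = 1000000 * M ^ 2 * K ^ 2)
    (hn : E * (25 * K * (25 * K) + 2) ≤ n) {c : Fin M → ℝ} (hc : ∑ a, c a = n) :
    ∃ A star, Profile n K c (n / E) (n / (1000 * M ^ 2 * K)) A star := by
  have hM1 : (1 : ℝ) ≤ M := by exact_mod_cast hM
  have hK1 : (1 : ℝ) ≤ K := by exact_mod_cast hK
  have hE' : (E : ℝ) = 1000000 * M ^ 2 * K ^ 2 := by rw [hE]; push_cast; ring
  have hEpos : (0 : ℝ) < E := by rw [hE']; positivity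
  have hn0 : (0 : ℝ) ≤ n := Nat.cast_nonneg n
  obtain ⟨star, -, hstar⟩ : ∃ a ∈ (Finset.univ : Finset (Fin M)), (n : ℝ) / M ≤ c a := by
    refine Finset.exists_le_of_sum_le ⟨⟨0, hM⟩, Finset.mem_univ _⟩ ?_
    rw [hc, Finset.sum_const, Finset.card_univ, Fintype.card_fin, nsmul_eq_mul]
    exact le_of_eq (by field_simp)
  refine ⟨Finset.univ.filter fun a => a ≠ star ∧ (n : ℝ) / (1000 * M ^ 2 * K) ≤ c a, star,
    hc, by simp, by simp, ?_, hstar, by positivity, hK, ?_, ?_, ?_, ?_⟩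
  · intro a ha haA
    simp only [Finset.mem_filter, Finset.mem_univ, true_and, not_and] at haA
    exact (not_le.1 (haA ha)).le
  · rw [hE']
    have e : 1 / (225 * (K : ℝ)) * (n / (1000 * M ^ 2 * K) - 2 * (n / (1000000 * M ^ 2 * K ^ 2))) -
        3 * (n / (1000000 * M ^ 2 * K ^ 2)) =
        n * (1000 * K - 2 - 675 * K) / (225 * 1000000 * M ^ 2 * K ^ 3) := by
      field_simp
      ring
    have : 0 ≤ n * (1000 * K - 2 - 675 * K) / (225 * 1000000 * (M : ℝ) ^ 2 * K ^ 3) :=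
      div_nonneg (mul_nonneg hn0 (by linarith)) (by positivity)
    linarith
  · rw [hE']
    have e : 1 / (225 * (K : ℝ)) * (n / (2 * M)) - M * (n / (1000 * M ^ 2 * K) +
        3 * (n / (1000000 * M ^ 2 * K ^ 2))) =
        n * (1000000 * K - 450 * (1000 * K + 3)) / (450 * 1000000 * M * K ^ 2) := by
      field_simp
      ring
    have : 0 ≤ n * (1000000 * K - 450 * (1000 * K + 3)) / (450 * 1000000 * (M : ℝ) * K ^ 2) :=
      div_nonneg (mul_nonneg hn0 (by linarith)) (by positivity)
    linarith
  · rw [hE']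
    have e : (n : ℝ) / (2 * M) - 2 * M * (n / (1000000 * M ^ 2 * K ^ 2)) =
        n * (1000000 * K ^ 2 - 4) / (2 * 1000000 * M * K ^ 2) := by
      field_simp
      ring
    have : 0 ≤ n * (1000000 * K ^ 2 - 4) / (2 * 1000000 * (M : ℝ) * K ^ 2) :=
      div_nonneg (mul_nonneg hn0 (by nlinarith)) (by positivity)
    linarith
  · rw [le_div_iff₀ hEpos]
    have : ((E * (25 * K * (25 * K) + 2) : ℕ) : ℝ) ≤ n := by exact_mod_cast hn
    push_cast at this ⊢
    linarith

theorem randomizedComputable_of_hasQueryMass {n M K E C s : ℕ} (hM : 0 < M) (hK : 0 < K)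
    (hE : E = 1000000 * M ^ 2 * K ^ 2) (hC : C = 25 * K * (25 * K)) (hs : s = 3 * M * E ^ 2 + 1)
    (hn : E * (C + 2) ≤ n) {F : (Fin n → Fin M) → ℝ} (hF : HasQueryMass F K)
    {X : Set (Fin n → Fin M)} (hX : IsSymmetric X) (f : X → Bool)
    (hf : ∀ x : X, (F x.1 < 1 / 3 ∧ f x = false) ∨ (2 / 3 < F x.1 ∧ f x = true)) :
    RandomizedComputable f (s + (2 * C + 1) * C) := by
  have hEpos : 0 < E := by rw [hE]; positivity
  have hnpos : 0 < n := lt_of_lt_of_le (by positivity) hn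
  have hspos : 0 < s := by omega
  have hside : ∀ x : X, side F x.1 = f x := by
    intro x
    rcases hf x with ⟨h1, h2⟩ | ⟨h1, h2⟩
    · rw [h2, side, decide_eq_false_iff_not]; linarith
    · rw [h2, side, decide_eq_true_eq]; linarith
  have hFX : ∀ x ∈ X, F x < 1 / 3 ∨ 2 / 3 < F x := fun x hx =>
    (hf ⟨x, hx⟩).imp And.left And.left
  have key : ∀ c : Fin M → ℝ, ∃ T : DecisionTree n M, T.depth ≤ (2 * C + 1) * C ∧
      (∑ a, c a = n → ∀ x : X, (∀ a, |(cnt x.1 a : ℝ) - c a| ≤ n / E) → T.eval x.1 = f x) := by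
    intro c
    by_cases hc : ∑ a, c a = n
    · obtain ⟨A, star, hP⟩ := exists_profile hM hK hE (hC ▸ hn) hc
      obtain ⟨pick, hp1, hp2⟩ := exists_proposal hF hP hX hFX
      refine ⟨DecisionTree.vote pick (2 * C + 1) ∅ (fun _ => ⟨0, hM⟩) 0,
        DecisionTree.depth_vote_le (hC ▸ hp1) _ _ _ _, fun _ x hx => ?_⟩
      obtain ⟨S, hS, hS2⟩ := hp2 x.1 x.2 hx
      rw [← hC] at hS
      rw [← hside x]
      refine DecisionTree.eval_vote hS2 _ _ _ _ (by simp) ?_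
      simp only [Finset.sdiff_empty, neg_zero, ite_self]
      push_cast
      omega
    · exact ⟨.leaf true, by simp [DecisionTree.depth], fun h => absurd h hc⟩
  choose T hT1 hT2 using key
  have : Nonempty (Fin n) := ⟨⟨0, hnpos⟩⟩
  refine randomizedComputable_of_family (Ω := Fin s → Fin n)
    (fun ω => DecisionTree.queryAll (List.ofFn ω) (fun _ => ⟨0, hM⟩) fun u =>
      T fun a => n / s * cnt (fun j => u (ω j)) a) (fun ω => ?_) fun x => ?_
  · refine (DecisionTree.depth_queryAll_le _ _ fun u => hT1 _).trans ?_
    rw [List.length_ofFn]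
  · have h1 := three_mul_card_bad_lt hnpos x.1 hEpos (s := s) (by omega)
    rw [Fintype.card_pi, Finset.prod_const, Finset.card_univ, Fintype.card_fin, Fintype.card_fin]
    refine lt_of_le_of_lt (Nat.mul_le_mul_left 3 (Finset.card_le_card fun ω hω => ?_)) h1
    rw [Finset.mem_filter] at hω ⊢
    refine ⟨hω.1, fun hgood => hω.2 ?_⟩
    rw [DecisionTree.eval_queryAll]
    -- The default entries are never used, since every sampled index has been read.
    have e : (fun j => if ω j ∈ List.ofFn ω then x.1 (ω j) else ⟨0, hM⟩) =
        fun j => x.1 (ω j) := by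
      funext j
      rw [if_pos (by simp)]
    rw [e]
    refine hT2 _ ?_ x hgood
    rw [← Finset.mul_sum, sum_cnt]
    have : (s : ℝ) ≠ 0 := Nat.cast_ne_zero.2 hspos.ne'
    field_simp

/-! ### From the query mass to the final bound -/

theorem R_le_mul_pow {n M K : ℕ} (hM : 0 < M) (hK : 0 < K) {F : (Fin n → Fin M) → ℝ}
    (hF : HasQueryMass F K) {X : Set (Fin n → Fin M)} (hX : IsSymmetric X) (f : X → Bool)
    (hf : ∀ x : X, (F x.1 < 1 / 3 ∧ f x = false) ∨ (2 / 3 < F x.1 ∧ f x = true)) :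
    R f ≤ 10 ^ 13 * (M ^ 5 * K ^ 4) := by
  have h1 : 1 ≤ M ^ 5 * K ^ 4 := Nat.one_le_iff_ne_zero.2 (by positivity)
  have h2 : K ^ 4 ≤ M ^ 5 * K ^ 4 := Nat.le_mul_of_pos_left _ (by positivity)
  have h3 : K ^ 2 ≤ K ^ 4 := Nat.pow_le_pow_right hK (by norm_num)
  have h4 : M ^ 2 * K ^ 4 ≤ M ^ 5 * K ^ 4 :=
    Nat.mul_le_mul_right _ (Nat.pow_le_pow_right hM (by norm_num))
  have h5 : M ^ 2 * K ^ 2 ≤ M ^ 2 * K ^ 4 := Nat.mul_le_mul_left _ h3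
  rcases le_or_gt (1000000 * M ^ 2 * K ^ 2 * (25 * K * (25 * K) + 2)) n with hn | hn
  · refine (Nat.sInf_le
      (randomizedComputable_of_hasQueryMass hM hK rfl rfl rfl hn hF hX f hf)).trans ?_
    calc _ = 3000000000000 * (M ^ 5 * K ^ 4) + 1 + (781250 * K ^ 4 + 625 * K ^ 2) := by ring
      _ ≤ 10 ^ 13 * (M ^ 5 * K ^ 4) := by omega
  · refine (Nat.sInf_le (randomizedComputable_self hM f)).trans (hn.le.trans ?_)
    calc _ = 625000000 * (M ^ 2 * K ^ 4) + 2000000 * (M ^ 2 * K ^ 2) := by ring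
      _ ≤ 10 ^ 13 * (M ^ 5 * K ^ 4) := by omega

theorem R_le_mul_Q_pow {n M : ℕ} (hM : 0 < M) {X : Set (Fin n → Fin M)} (hX : IsSymmetric X)
    (f : X → Bool) : R f ≤ 10 ^ 18 * M ^ 5 * Q f ^ 8 := by
  obtain ⟨A, hA⟩ : QuantumComputable f (Q f) := Nat.sInf_mem (exists_quantumComputable hM f)
  have hF := A.hasQueryMass (Q f) true
  have hf : ∀ x : X, (A.prob (Q f) x.1 true < 1 / 3 ∧ f x = false) ∨
      (2 / 3 < A.prob (Q f) x.1 true ∧ f x = true) := by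
    intro x
    have h1 := hA x
    have h2 := A.prob_add_prob_not x.1 (Q f) true
    cases hfx : f x
    · rw [hfx] at h1
      exact Or.inl ⟨h1, rfl⟩
    · rw [hfx] at h1
      exact Or.inr ⟨by linarith, rfl⟩
  -- `R_le_mul_pow` needs `0 < K`. With no queries the mass is 0, so the acceptance probability, and
  -- with it `f`, is constant.
  rcases Nat.eq_zero_or_pos (Q f) with h0 | hpos
  · have hconst : ∀ x y : X, f x = f y := by
      intro x y
      obtain ⟨ν, hν, hsum, hle⟩ := hF x.1
      have h1 : (A.prob (Q f) x.1 true - A.prob (Q f) y.1 true) ^ 2 ≤ 0 := by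
        refine (hle y.1).trans ((Finset.sum_le_sum_of_subset_of_nonneg (Finset.filter_subset _ _)
          fun i _ _ => hν i).trans (hsum.trans (le_of_eq ?_)))
        rw [h0]; simp
      have h2 : A.prob (Q f) x.1 true - A.prob (Q f) y.1 true = 0 :=
        pow_eq_zero_iff (two_ne_zero) |>.1 (le_antisymm h1 (sq_nonneg _))
      rcases hf x with ⟨h3, h4⟩ | ⟨h3, h4⟩ <;> rcases hf y with ⟨h5, h6⟩ | ⟨h5, h6⟩
      · rw [h4, h6]
      · linarith
      · linarith
      · rw [h4, h6]
    have hR : RandomizedComputable f 0 := by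
      rcases isEmpty_or_nonempty X with he | ⟨⟨x₀⟩⟩
      · exact randomizedComputable_of_tree (.leaf true) (by simp [DecisionTree.depth])
          fun x => he.elim x
      · exact randomizedComputable_of_tree (.leaf (f x₀)) (by simp [DecisionTree.depth])
          fun x => hconst x₀ x
    exact (Nat.sInf_le hR).trans (Nat.zero_le _)
  · have hF' : HasQueryMass (fun x => A.prob (Q f) x true) ((16 * Q f ^ 2 : ℕ) : ℝ) := by
      push_cast
      exact hF
    refine (R_le_mul_pow hM (by positivity) hF' hX f hf).trans ?_
    calc _ = 655360000000000000 * (M ^ 5 * Q f ^ 8) := by ring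
      _ ≤ 1000000000000000000 * (M ^ 5 * Q f ^ 8) := Nat.mul_le_mul_right _ (by norm_num)
      _ = _ := by ring

theorem mul_rpow_R_le_Q {n M : ℕ} (hM : 2 ≤ M) {X : Set (Fin n → Fin M)} (hX : IsSymmetric X)
    (f : X → Bool) :
    1 / (10 ^ 18 * (M : ℝ) ^ 5) * (R f : ℝ) ^ (1 / (12 * ((M : ℝ) - 1))) ≤ (Q f : ℝ) := by
  have hR := R_le_mul_Q_pow (by omega) hX f
  have hk : 12 * (M - 1) ≠ 0 := by omega
  have hexp : 1 / (12 * ((M : ℝ) - 1)) = ((12 * (M - 1) : ℕ) : ℝ)⁻¹ := by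
    rw [one_div]
    push_cast [Nat.cast_sub (by omega : 1 ≤ M)]
    rfl
  have hB : 1 ≤ 10 ^ 18 * M ^ 5 := Nat.one_le_iff_ne_zero.2 (by positivity)
  -- Raising the exponent from 8 to `12 (M - 1)` is allowed for a positive integer base; if `Q f =
  -- 0`, then `R f = 0` as well.
  have hpow : R f ≤ (10 ^ 18 * M ^ 5 * Q f) ^ (12 * (M - 1)) := by
    rcases Nat.eq_zero_or_pos (Q f) with h0 | hpos
    · rw [h0] at hR
      simpa using (hR.trans (by simp)).trans (Nat.zero_le _)
    · calc R f ≤ 10 ^ 18 * M ^ 5 * Q f ^ 8 := hR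
        _ ≤ (10 ^ 18 * M ^ 5) ^ 8 * Q f ^ 8 :=
          Nat.mul_le_mul_right _ (Nat.le_self_pow (by norm_num) _)
        _ = (10 ^ 18 * M ^ 5 * Q f) ^ 8 := (mul_pow _ _ _).symm
        _ ≤ _ := Nat.pow_le_pow_right (by positivity) (by omega)
  have hM0 : (0 : ℝ) < M := Nat.cast_pos.2 (by omega)
  rw [hexp, one_div, inv_mul_le_iff₀ (by positivity)]
  calc (R f : ℝ) ^ (((12 * (M - 1) : ℕ) : ℝ)⁻¹)
      ≤ ((10 ^ 18 * (M : ℝ) ^ 5 * Q f) ^ (12 * (M - 1))) ^ (((12 * (M - 1) : ℕ) : ℝ)⁻¹) :=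
        Real.rpow_le_rpow (Nat.cast_nonneg _) (by exact_mod_cast hpow) (by positivity)
    _ = 10 ^ 18 * (M : ℝ) ^ 5 * Q f := Real.pow_rpow_inv_natCast (by positivity) hk

end QueryComplexity

theorem mainTheorem2 :
    (∀ M : ℕ, 2 ≤ M → ∃ c : ℝ, 0 < c ∧
      ∀ (n : ℕ) (X : Set (Fin n → Fin M)), QueryComplexity.IsSymmetric X → ∀ f : X → Bool,
        c * (QueryComplexity.R f : ℝ) ^ (1 / (12 * ((M : ℝ) - 1))) ≤ (QueryComplexity.Q f : ℝ)) ∧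
    (∃ c : ℝ, 0 < c ∧
      ∀ (n : ℕ) (X : Set (Fin n → Fin 2)), QueryComplexity.IsSymmetric X → ∀ f : X → Bool,
        c * (QueryComplexity.R f : ℝ) ^ (1 / 12 : ℝ) ≤ (QueryComplexity.Q f : ℝ)) := by
  have main : ∀ M : ℕ, 2 ≤ M → ∃ c : ℝ, 0 < c ∧
      ∀ (n : ℕ) (X : Set (Fin n → Fin M)), QueryComplexity.IsSymmetric X → ∀ f : X → Bool,
        c * (QueryComplexity.R f : ℝ) ^ (1 / (12 * ((M : ℝ) - 1))) ≤ (QueryComplexity.Q f : ℝ) := by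
    intro M hM
    have hM0 : (0 : ℝ) < M := Nat.cast_pos.2 (by omega)
    exact ⟨1 / (10 ^ 18 * (M : ℝ) ^ 5), by positivity,
      fun n X hX f => QueryComplexity.mul_rpow_R_le_Q hM hX f⟩
  refine ⟨main, ?_⟩
  obtain ⟨c, hc, h⟩ := main 2 le_rfl
  refine ⟨c, hc, fun n X hX f => ?_⟩
  have h2 := h n X hX f
  norm_num at h2 ⊢
  exact h2
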